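/- **Setting.** Fix $\alpha,\sigma>0$ and functions $F_t,G_t:\mathbb{R}^{2t+1}\to\mathbb{R}$ ($t\ge 1$), not depending on $N$, which are $C^\infty_{1b}$, i.e. $C^\infty$ with all partial derivatives of non-zero order uniformly bounded (in particular each is Lipschitz). Let $N,d\geq 1$ with $d=\alpha N$. Let $X\in\mathbb{R}^{N\times d}$, $\theta,v^0\in\mathbb{R}^d$, $w^t\in\mathbb{R}^N$, $\tilde w^t\in\mathbb{R}^d$ $(t\ge1)$ be random, and define $b^*=X\theta$ and, for $t\ge 1$ (with $F_t,G_t$ applied coordinatewise), $$b^t=Xv^{t-1},\quad u^t=F_t(b^*,b^1,\dots,b^t;w^1,\dots,w^t),\quad h^t=X^{\mathsf T}u^t,\quad v^t=G_t(h^1,\dots,h^t;v^0,\tilde w^1,\dots,\tilde w^t).$$ For a random variable $Y$ write $\|Y\|_{\psi_2}=\inf\{r>0:\mathbb{E}e^{Y^2/r^2}\le 2\}$, call $Y$ $K$-subgaussian if $\|Y\|_{\psi_2}\le K$, and write $\|Y\|_p=\mathbb{E}[|Y|^p]^{1/p}$. Assume: * the entries of $X$ are independent, centered and $\sigma/\sqrt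 N$-subgaussian (they need not be identically distributed, and no variance is prescribed); * the pairs $(\theta_j,v^0_j)$, $j\in[d]$, are i.i.d. and independent of $X$, and their common law $\nu_0$ has $\sigma$-subgaussian coordinates; * the entries of all $w^t,\tilde w^t$ are i.i.d. $N(0,1)$ and independent of $(X,\theta,v^0)$. **Derivatives.** Let $P$ be a finite multiset whose elements are among the variables $X_{ij}$, $b^*_i$, $b^s_i$, $h^s_j$ ($i\in[N]$, $j\in[d]$, $s\ge1$), and let $|P|$ be its size with multiplicity. Here $\partial_P$ is the iterated partial derivative in all variables of $P$, where differentiation in a field variable means the following: replace the defining equations of the fields by $b^*=X\theta+\beta^*$, $b^s=Xv^{s-1}+\beta^s$, $h^s=X^{\mathsf T}u^s+\gamma^s$, regard every dynamical variable as a function of $X$ and the external fields $\beta^*,\beta^s,\gamma^s$, and let $\partial_{b^*_i},\partial_{b^s_i},\partial_{h^s_j}$ be the derivatives in $\beta^*_i,\beta^s_i,\gamma^s_j$. All derivatives are evaluated at the given $X$ and at zero external fields. Let $G(P)$ be the subgraph of the complete bipartite graph with parts $[d]$ and $[N]$ whose edges are the pairs $\{i,j\}$ with $X_{ij}\in P$,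 and whose vertices are the endpoints of these edges, all $j\in[d]$ such that some $h^s_j\in P$, and all $i\in[N]$ such that $b^*_i\in P$ or some $b^s_i\in P$. A vertex $k\in[d]\sqcup[N]$ is *all-reaching* in $P$ if $|P|=0$, or if $k$ is a vertex of $G(P)$ and $G(P)$ is connected. **Theorem.** For every integer $t\ge1$, real $p\ge1$ and integer $m\ge0$ there is a constant $\Gamma_{t,m,p}$, depending only on $t,m,p,\alpha,\sigma$ and the functions $F_\cdot,G_\cdot$ (in particular not on $N$), such that for all $N,d$ and all random inputs as above, every multiset $P$ as above with $|P|=m$, and all $i\in[N]$, $j\in[d]$, $s\in\{1,\dots,t\}$: 1. $\max\{\|\partial_Pb^*_i\|_p,\|\partial_Pb^s_i\|_p,\|\partial_Pu^s_i\|_p,\|\partial_Ph^s_j\|_p,\|\partial_Pv^s_j\|_p\}\le\Gamma_{t,m,p}$. 2. If $i$ is not all-reaching in $P$, then $\max\{\|\partial_Pb^*_i\|_p,\|\partial_Pb^s_i\|_p,\|\partial_Pu^s_i\|_p\}\le\Gamma_{t,m,p}/\sqrt N$. If $j$ is not all-reaching in $P$, then $\max\{\|\partial_Ph^s_j\|_p,\|\partial_Pv^s_j\|_p\}\le\Gamma_{t,m,p}/\sqrt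 N$. -/

import Mathlib

open MeasureTheory ProbabilityTheory

noncomputable section

/-- The class `C^∞_{1b}`: smooth functions all of whose derivatives of non-zero order are
uniformly bounded. (In particular such a function is Lipschitz.) -/
def IsSmooth1b {E : Type*} [NormedAddCommGroup E] [NormedSpace ℝ E] (f : E → ℝ) : Prop :=
  ContDiff ℝ ((⊤ : ℕ∞) : WithTop ℕ∞) f ∧
    ∀ k : ℕ, 1 ≤ k → ∃ C : ℝ, ∀ x, ‖iteratedFDeriv ℝ k f x‖ ≤ C

/-- The subgaussian norm `inf {t > 0 : 𝔼 exp (Y² / t²) ≤ 2}`, with values in `[0, ∞]`. -/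
def subgaussianNorm {Ω : Type*} [MeasurableSpace Ω] (μ : Measure Ω) (Y : Ω → ℝ) : ENNReal :=
  sInf {r | ∃ t : ℝ, 0 < t ∧ r = ENNReal.ofReal t ∧
    ∫⁻ ω, ENNReal.ofReal (Real.exp (Y ω ^ 2 / t ^ 2)) ∂μ ≤ 2}

/-- `Y` is `K`-subgaussian. -/
def IsSubgaussian {Ω : Type*} [MeasurableSpace Ω] (μ : Measure Ω) (K : ℝ) (Y : Ω → ℝ) : Prop :=
  subgaussianNorm μ Y ≤ ENNReal.ofReal K

namespace GFOM

/-- The variables with respect to which one differentiates: the entries of the matrix `X`, and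
the entries of the fields `b*`, `b^s`, `h^s`. (Times start at `s = 1`; nothing at a time `≥ 1`
depends on the variables with `s = 0`.) -/
inductive DVar (N d : ℕ) : Type
  | X (i : Fin N) (j : Fin d)
  | bstar (i : Fin N)
  | b (s : ℕ) (i : Fin N)
  | h (s : ℕ) (j : Fin d)
  deriving DecidableEq

/-- The input of the iteration: the matrix, the signal, the initialization and the two families
of noise vectors `w^s`, `w̃^s`, `s ≥ 1`. -/
structure Data (N d : ℕ) where
  X : Fin N → Fin d → ℝ
  θ : Fin d → ℝ
  v0 : Fin d → ℝ
  w : ℕ → Fin N → ℝ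
  wt : ℕ → Fin d → ℝ

/-- The type of `F_t : ℝ^{2t+1} → ℝ`, with argument `(b*, (b^1, …, b^t), (w^1, …, w^t))`. -/
abbrev FFun : Type := (t : ℕ) → ℝ × (Fin t → ℝ) × (Fin t → ℝ) → ℝ

/-- The type of `G_t : ℝ^{2t+1} → ℝ`, with argument `((h^1, …, h^t), v^0, (w̃^1, …, w̃^t))`. -/
abbrev GFun : Type := (t : ℕ) → (Fin t → ℝ) × ℝ × (Fin t → ℝ) → ℝ

section Orbit

variable {N d : ℕ} (F : FFun) (G : GFun) (D : Data N d) (z : DVar N d → ℝ)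

/-- `b* = X θ`, with matrix entries `z (X i j)` and external field `z (bstar i)`. -/
def bstar (i : Fin N) : ℝ := ∑ j, z (.X i j) * D.θ j + z (.bstar i)

-- The orbit with matrix entries `z (X i j)`, in which an external field `z (b s i)`, `z (h s j)`
-- is added to the fields `b^s_i`, `h^s_j`. Differentiating in these external fields at `0` is
-- differentiating with respect to the fields.
mutual

/-- `b^t = X v^{t-1}` (plus external field), for `t ≥ 1`. -/
def b : ℕ → Fin N → ℝ
  | 0, _ => 0
  | t + 1, i => ∑ j, z (.X i j) * v t j + z (.b (t + 1) i)
termination_by t => 4 * t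

/-- `u^t = F_t(b*, b^1, …, b^t; w^1, …, w^t)`, for `t ≥ 1`. -/
def u (t : ℕ) (i : Fin N) : ℝ :=
  F t (bstar D z i, fun k : Fin t => b (k + 1) i, fun k : Fin t => D.w (k + 1) i)
termination_by 4 * t + 1
decreasing_by omega

/-- `h^t = Xᵀ u^t` (plus external field), for `t ≥ 1`. -/
def h (t : ℕ) (j : Fin d) : ℝ := ∑ i, z (.X i j) * u t i + z (.h t j)
termination_by 4 * t + 2

/-- `v^t = G_t(h^1, …, h^t; v^0, w̃^1, …, w̃^t)`, for `t ≥ 1`. -/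
def v : ℕ → Fin d → ℝ
  | 0, j => D.v0 j
  | t + 1, j => G (t + 1)
      (fun k : Fin (t + 1) => h (k + 1) j, D.v0 j, fun k : Fin (t + 1) => D.wt (k + 1) j)
termination_by t => 4 * t + 3
decreasing_by omega

end

end Orbit

/-- The point at which derivatives are taken: matrix `x`, all external fields zero (so that the
orbit is the original one). -/
def basePoint {N d : ℕ} (x : Fin N → Fin d → ℝ) : DVar N d → ℝ
  | .X i j => x i j
  | _ => 0

/-- The iterated partial derivative `∂_{a₁} ⋯ ∂_{aₘ} f` for a list `a₁, …, aₘ` of coordinates. -/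
def partialDerivs {ι : Type*} [DecidableEq ι] (l : List ι) (f : (ι → ℝ) → ℝ) : (ι → ℝ) → ℝ :=
  l.foldr (fun a g z => lineDeriv ℝ g z (Pi.single a 1)) f

/-- `∂_P Y` at the data `D`, where the dynamical variable `Y` is given as a function of the data
and of the matrix entries and external fields. The list `P` enumerates the multiset. -/
def dP {N d : ℕ} (P : List (DVar N d)) (Y : Data N d → (DVar N d → ℝ) → ℝ) (D : Data N d) : ℝ :=
  partialDerivs P (Y D) (basePoint D.X)

/-- The subgraph `G(P)` of the complete bipartite graph with parts `[d]` and `[N]`. -/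
def graph {N d : ℕ} (P : Multiset (DVar N d)) :
    (completeBipartiteGraph (Fin d) (Fin N)).Subgraph where
  verts := {k | match k with
    | .inl j => (∃ s, DVar.h s j ∈ P) ∨ ∃ i, DVar.X i j ∈ P
    | .inr i => DVar.bstar i ∈ P ∨ (∃ s, DVar.b s i ∈ P) ∨ ∃ j, DVar.X i j ∈ P}
  Adj k l := match k, l with
    | .inl j, .inr i => DVar.X i j ∈ P
    | .inr i, .inl j => DVar.X i j ∈ P
    | _, _ => False
  adj_sub := by
    rintro (j | i) (j' | i') hh <;> simp_all
  edge_vert := by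
    rintro (j | i) (j' | i') hh
    · exact hh.elim
    · exact Or.inr ⟨_, hh⟩
    · exact Or.inr (Or.inr ⟨_, hh⟩)
    · exact hh.elim
  symm := ⟨by
    rintro (j | i) (j' | i') hh <;> exact hh⟩

/-- The vertex `k ∈ [d] ⊔ [N]` is all-reaching in `P`. -/
def AllReaching {N d : ℕ} (P : Multiset (DVar N d)) (k : Fin d ⊕ Fin N) : Prop :=
  P.card = 0 ∨ (k ∈ (graph P).verts ∧ (graph P).Connected)

/-- The probabilistic assumptions on the random data. -/
structure Assumptions {N d : ℕ} {Ω : Type*} [MeasurableSpace Ω] (μ : Measure Ω) (σ : ℝ)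
    (ν₀ : Measure (ℝ × ℝ)) (D : Ω → Data N d) : Prop where
  -- the entries of `X` are independent, centered and `σ/√N`-subgaussian
  meas_X : ∀ i j, Measurable fun ω => (D ω).X i j
  indep_X : iIndepFun (fun (a : Fin N × Fin d) ω => (D ω).X a.1 a.2) μ
  mean_X : ∀ i j, ∫ ω, (D ω).X i j ∂μ = 0
  subgaussian_X : ∀ i j, IsSubgaussian μ (σ / √(N : ℝ)) fun ω => (D ω).X i j
  -- the pairs `(θ_j, v⁰_j)` are i.i.d. with law `ν₀`, which is `σ`-subgaussian, and
  -- are independent of `X`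
  meas_init : ∀ j, Measurable fun ω => ((D ω).θ j, (D ω).v0 j)
  law_init : ∀ j, μ.map (fun ω => ((D ω).θ j, (D ω).v0 j)) = ν₀
  indep_init : iIndepFun (fun j ω => ((D ω).θ j, (D ω).v0 j)) μ
  subgaussian_fst : IsSubgaussian ν₀ σ Prod.fst
  subgaussian_snd : IsSubgaussian ν₀ σ Prod.snd
  indep_init_X : IndepFun (fun ω => ((D ω).θ, (D ω).v0)) (fun ω => (D ω).X) μ
  -- the noise entries are i.i.d. standard Gaussian, independent of everything else
  meas_w : ∀ s i, Measurable fun ω => (D ω).w (s + 1) i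
  law_w : ∀ s i, μ.map (fun ω => (D ω).w (s + 1) i) = gaussianReal 0 1
  indep_w : iIndepFun (fun (a : ℕ × Fin N) ω => (D ω).w (a.1 + 1) a.2) μ
  meas_wt : ∀ s j, Measurable fun ω => (D ω).wt (s + 1) j
  law_wt : ∀ s j, μ.map (fun ω => (D ω).wt (s + 1) j) = gaussianReal 0 1
  indep_wt : iIndepFun (fun (a : ℕ × Fin d) ω => (D ω).wt (a.1 + 1) a.2) μ
  indep_w_rest : IndepFun (fun ω s i => (D ω).w (s + 1) i)
    (fun ω => ((D ω).X, (D ω).θ, (D ω).v0)) μ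
  indep_wt_rest : IndepFun (fun ω s j => (D ω).wt (s + 1) j)
    (fun ω => ((D ω).X, (D ω).θ, (D ω).v0, fun s i => (D ω).w (s + 1) i)) μ

/-- The `p`-th moment norm `𝔼[|Y|^p]^{1/p}`, in `[0, ∞]`. -/
def momentNorm {Ω : Type*} [MeasurableSpace Ω] (μ : Measure Ω) (p : ℝ) (Y : Ω → ℝ) : ENNReal :=
  eLpNorm Y (ENNReal.ofReal p) μ

end GFOM

end

noncomputable section

open scoped NNReal ENNReal

namespace GFOM

universe u

-- Attach to a variable at the vertex `k` the weight `wt k P`, equal to 1 if `k` is all-reaching in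
-- `P` and to `1/√N` otherwise. The claim is that every moment of `∂_P` of that variable is at most
-- a constant times this weight. It is proved by induction along the orbit, since both operations
-- that build the orbit preserve such bounds.
--
-- Nonlinearities (`IsSmooth1b.exists_good`): by the chain and Leibniz rules, `∂_P f(y)` is a sum of
-- products of bounded derivatives of `f` with factors `∂_Q y`, where the sets `Q` partition `P`. If
-- `k` is all-reaching in every block, then it is all-reaching in `P`; otherwise some factor already
-- supplies `1/√N`.
--
-- Matrix products (`Good.linear`): consider `∂_P ∑_j X_ij v_j`. At most `2|P|` indices `j` are
-- vertices of `G(P)`, and these terms are bounded one by one. In each, either `X_ij` stays and has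
-- size `1/√N`, or it is differentiated, and then the edge `ij` carries all-reachingness from `j` to
-- `i`. For the other indices, `P` cannot contain `X_ij`, so what remains is `∑_j X_ij ∂_P v_j`, a
-- sum of `O(N)` terms that must be bounded by cancellation.
--
-- The cancellation (`eLpNorm_sum_entries_le`) comes from expanding an even moment over tuples of
-- entries. An entry that occurs exactly once in a tuple is centered and independent of the rest, so
-- the remaining factor may be replaced by its difference from its value with this entry set to
-- zero. That difference is the entry times an averaged derivative, and gains a further `1/√N`.
-- Every distinct entry of the tuple thus contributes at least `1/N`, which pays for the number of
-- tuples. No variance or common law of the entries is needed.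
--
-- The gain requires that further derivatives of `∂_P v_j`, in edges from `i` to vertices outside
-- `G(P)`, still have the order of the weight of `i` in `P`. This is a statement on graphs
-- (`allReaching_of_star`): adding such a star cannot make an outside vertex all-reaching unless `i`
-- was all-reaching in `P`.
--
-- The averaged derivative is evaluated at data with a rescaled entry. All bounds are therefore
-- proved uniformly over a class `Model` of random data that is stable under multiplying an entry by
-- a number in `[0,1]`.

/-- Functionals of the data and of the matrix entries and external fields. -/
abbrev Fnl (N d : ℕ) : Type := Data N d → (DVar N d → ℝ) → ℝ

-- Iterated partial derivatives, the Leibniz rule and difference operators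

section Calculus

variable {N d : ℕ}

/-- The components of the data that enter the iteration. -/
def Data.toProd (D : Data N d) : (Fin N → Fin d → ℝ) × (Fin d → ℝ) × (Fin d → ℝ) ×
    (ℕ → Fin N → ℝ) × (ℕ → Fin d → ℝ) :=
  (D.X, D.θ, D.v0, fun s i => D.w (s + 1) i, fun s j => D.wt (s + 1) j)

/-- Noise at time zero is left out, because the assumptions say nothing about its measurability and
the orbit does not use it at times `≥ 1`. -/
instance : MeasurableSpace (Data N d) := MeasurableSpace.comap Data.toProd inferInstance

theorem Data.measurable_toProd : Measurable (Data.toProd : Data N d → _) :=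
  comap_measurable _

/-- The data with the matrix replaced by `x`. -/
def Data.withX (D : Data N d) (x : Fin N → Fin d → ℝ) : Data N d := { D with X := x }

/-- The partial derivative of a functional in the coordinate `a`. -/
def pd (a : DVar N d) (Y : Fnl N d) : Fnl N d := fun D z => lineDeriv ℝ (Y D) z (Pi.single a 1)

/-- The iterated partial derivative of a functional. -/
def pdl (P : List (DVar N d)) (Y : Fnl N d) : Fnl N d := fun D z => partialDerivs P (Y D) z

@[simp] theorem pdl_nil (Y : Fnl N d) : pdl [] Y = Y := rfl

theorem pdl_cons (a : DVar N d) (P : List (DVar N d)) (Y : Fnl N d) :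
    pdl (a :: P) Y = pd a (pdl P Y) := rfl

theorem pdl_append (P Q : List (DVar N d)) (Y : Fnl N d) :
    pdl (P ++ Q) Y = pdl P (pdl Q Y) := by
  induction P with
  | nil => rfl
  | cons a P ih => rw [List.cons_append, pdl_cons, ih, pdl_cons]

theorem pdl_concat (P : List (DVar N d)) (a : DVar N d) (Y : Fnl N d) :
    pdl (P ++ [a]) Y = pdl P (pd a Y) := pdl_append P [a] Y

/-- `Y'` is the partial derivative of `Y` in the coordinate `a`. -/
def HasPD (a : DVar N d) (Y Y' : Fnl N d) : Prop :=
  ∀ D z, HasLineDerivAt ℝ (Y D) (Y' D z) z (Pi.single a 1)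

theorem HasPD.pd_eq {a : DVar N d} {Y Y' : Fnl N d} (hY : HasPD a Y Y') : pd a Y = Y' := by
  funext D z
  exact (hY D z).lineDeriv

/-- A functional that does not depend on the matrix of the data, and is jointly measurable. -/
structure IsBase (Y : Fnl N d) : Prop where
  inv : ∀ D x, Y (D.withX x) = Y D
  meas : Measurable fun q : Data N d × (DVar N d → ℝ) => Y q.1 q.2

/-- Functionals that have partial derivatives up to order `n`. -/
def SmoothN : ℕ → Fnl N d → Prop
  | 0, Y => IsBase Y
  | n + 1, Y => IsBase Y ∧ ∀ a, ∃ Y', HasPD a Y Y' ∧ SmoothN n Y'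

/-- Functionals that have partial derivatives of all orders. -/
def Smooth (Y : Fnl N d) : Prop := ∀ n, SmoothN n Y

theorem SmoothN.isBase : ∀ {n : ℕ} {Y : Fnl N d}, SmoothN n Y → IsBase Y
  | 0, _, hY => hY
  | _ + 1, _, hY => hY.1

theorem SmoothN.of_succ : ∀ {n : ℕ} {Y : Fnl N d}, SmoothN (n + 1) Y → SmoothN n Y
  | 0, _, hY => hY.1
  | _ + 1, _, hY => ⟨hY.1, fun a => by
      obtain ⟨Y', h₁, h₂⟩ := hY.2 a
      exact ⟨Y', h₁, h₂.of_succ⟩⟩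

theorem Smooth.isBase {Y : Fnl N d} (hY : Smooth Y) : IsBase Y := (hY 0).isBase

theorem Smooth.hasPD {Y : Fnl N d} (hY : Smooth Y) (a : DVar N d) : HasPD a Y (pd a Y) := by
  obtain ⟨Y', h₁, -⟩ := (hY 1).2 a
  rwa [h₁.pd_eq]

theorem Smooth.pd {Y : Fnl N d} (hY : Smooth Y) (a : DVar N d) : Smooth (pd a Y) := by
  intro n
  obtain ⟨Y', h₁, h₂⟩ := (hY (n + 1)).2 a
  rwa [h₁.pd_eq]

theorem Smooth.pdl {Y : Fnl N d} (hY : Smooth Y) (P : List (DVar N d)) : Smooth (pdl P Y) := by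
  induction P with
  | nil => exact hY
  | cons a P ih => exact ih.pd a

theorem IsBase.add {Y Z : Fnl N d} (hY : IsBase Y) (hZ : IsBase Z) : IsBase (Y + Z) :=
  ⟨fun D x => by simp [hY.inv, hZ.inv], hY.meas.add hZ.meas⟩

theorem IsBase.mul {Y Z : Fnl N d} (hY : IsBase Y) (hZ : IsBase Z) : IsBase (Y * Z) :=
  ⟨fun D x => by simp [hY.inv, hZ.inv], hY.meas.mul hZ.meas⟩

theorem HasPD.add {a : DVar N d} {Y Y' Z Z' : Fnl N d} (hY : HasPD a Y Y') (hZ : HasPD a Z Z') :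
    HasPD a (Y + Z) (Y' + Z') := fun D z => HasDerivAt.add (hY D z) (hZ D z)

theorem HasPD.mul {a : DVar N d} {Y Y' Z Z' : Fnl N d} (hY : HasPD a Y Y') (hZ : HasPD a Z Z') :
    HasPD a (Y * Z) (Y' * Z + Y * Z') := fun D z => by
  have := HasDerivAt.fun_mul (hY D z) (hZ D z)
  rw [zero_smul, add_zero] at this
  exact this

theorem IsBase.const {φ : Data N d → ℝ} (hφ : Measurable φ) (hinv : ∀ D x, φ (D.withX x) = φ D) :
    IsBase (fun D _ => φ D : Fnl N d) :=
  ⟨fun D x => by funext; exact hinv D x, hφ.comp measurable_fst⟩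

theorem HasPD.const (a : DVar N d) (φ : Data N d → ℝ) : HasPD a (fun D _ => φ D) 0 :=
  fun _ _ => hasDerivAt_const _ _

theorem IsBase.zero : IsBase (0 : Fnl N d) := ⟨fun _ _ => rfl, measurable_const⟩

theorem SmoothN.zero : ∀ n, SmoothN n (0 : Fnl N d)
  | 0 => IsBase.zero
  | n + 1 => ⟨IsBase.zero, fun a => ⟨0, HasPD.const a fun _ => 0, SmoothN.zero n⟩⟩

theorem Smooth.zero : Smooth (0 : Fnl N d) := SmoothN.zero

theorem Smooth.const {φ : Data N d → ℝ} (hφ : Measurable φ)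
    (hinv : ∀ D x, φ (D.withX x) = φ D) : Smooth (fun D _ => φ D : Fnl N d)
  | 0 => IsBase.const hφ hinv
  | n + 1 => ⟨IsBase.const hφ hinv, fun a => ⟨0, HasPD.const a φ, SmoothN.zero n⟩⟩

/-- The coordinate functional `z ↦ z a`. -/
def coord (a : DVar N d) : Fnl N d := fun _ z => z a

theorem HasPD.coord (a b : DVar N d) :
    HasPD b (coord a) (fun _ _ => if a = b then 1 else 0) := fun D z => by
  have : HasDerivAt (fun t : ℝ => z a + t * (Pi.single b 1 : DVar N d → ℝ) a)
      (1 * (Pi.single b 1 : DVar N d → ℝ) a) 0 :=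
    ((hasDerivAt_id (0 : ℝ)).mul_const _).const_add _
  simpa [HasLineDerivAt, GFOM.coord, Pi.single_apply] using this

theorem Smooth.coord (a : DVar N d) : Smooth (coord a) := by
  have hb : IsBase (GFOM.coord a) := ⟨fun _ _ => rfl, (measurable_pi_apply a).comp measurable_snd⟩
  rintro (_ | n)
  · exact hb
  · exact ⟨hb, fun b => ⟨_, HasPD.coord a b,
      Smooth.const (φ := fun _ => if a = b then 1 else 0) measurable_const (fun _ _ => rfl) n⟩⟩

theorem SmoothN.add : ∀ {n : ℕ} {Y Z : Fnl N d}, SmoothN n Y → SmoothN n Z → SmoothN n (Y + Z)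
  | 0, _, _, hY, hZ => IsBase.add hY hZ
  | _ + 1, _, _, hY, hZ => ⟨hY.1.add hZ.1, fun a => by
      obtain ⟨Y', h₁, h₂⟩ := hY.2 a
      obtain ⟨Z', h₃, h₄⟩ := hZ.2 a
      exact ⟨_, h₁.add h₃, h₂.add h₄⟩⟩

theorem SmoothN.mul : ∀ {n : ℕ} {Y Z : Fnl N d}, SmoothN n Y → SmoothN n Z → SmoothN n (Y * Z)
  | 0, _, _, hY, hZ => IsBase.mul hY hZ
  | _ + 1, _, _, hY, hZ => ⟨hY.1.mul hZ.1, fun a => by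
      obtain ⟨Y', h₁, h₂⟩ := hY.2 a
      obtain ⟨Z', h₃, h₄⟩ := hZ.2 a
      exact ⟨_, h₁.mul h₃, (h₂.mul hZ.of_succ).add (hY.of_succ.mul h₄)⟩⟩

theorem Smooth.add {Y Z : Fnl N d} (hY : Smooth Y) (hZ : Smooth Z) : Smooth (Y + Z) :=
  fun n => (hY n).add (hZ n)

theorem Smooth.mul {Y Z : Fnl N d} (hY : Smooth Y) (hZ : Smooth Z) : Smooth (Y * Z) :=
  fun n => (hY n).mul (hZ n)

theorem SmoothN.sum {n : ℕ} {κ : Type*} (s : Finset κ) {Y : κ → Fnl N d}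
    (hY : ∀ k ∈ s, SmoothN n (Y k)) : SmoothN n (∑ k ∈ s, Y k) := by
  classical
  induction s using Finset.induction_on with
  | empty => simpa using SmoothN.zero n
  | insert k s hk ih =>
    rw [Finset.sum_insert hk]
    exact (hY k (by simp)).add (ih fun l hl => hY l (by simp [hl]))

theorem Smooth.sum {κ : Type*} (s : Finset κ) {Y : κ → Fnl N d}
    (hY : ∀ k ∈ s, Smooth (Y k)) : Smooth (∑ k ∈ s, Y k) :=
  fun n => SmoothN.sum s fun k hk => hY k hk n

theorem Smooth.one : Smooth (1 : Fnl N d) :=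
  Smooth.const (φ := fun _ => 1) measurable_const fun _ _ => rfl

theorem Smooth.prod {κ : Type*} (s : Finset κ) {Y : κ → Fnl N d}
    (hY : ∀ k ∈ s, Smooth (Y k)) : Smooth (∏ k ∈ s, Y k) := by
  classical
  induction s using Finset.induction_on with
  | empty => simpa using Smooth.one
  | insert k s hk ih =>
    rw [Finset.prod_insert hk]
    exact (hY k (by simp)).mul (ih fun l hl => hY l (by simp [hl]))

theorem pd_add {Y Z : Fnl N d} (hY : Smooth Y) (hZ : Smooth Z) (a : DVar N d) :
    pd a (Y + Z) = pd a Y + pd a Z := ((hY.hasPD a).add (hZ.hasPD a)).pd_eq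

theorem pd_mul {Y Z : Fnl N d} (hY : Smooth Y) (hZ : Smooth Z) (a : DVar N d) :
    pd a (Y * Z) = pd a Y * Z + Y * pd a Z := ((hY.hasPD a).mul (hZ.hasPD a)).pd_eq

theorem pdl_add {Y Z : Fnl N d} (hY : Smooth Y) (hZ : Smooth Z) (P : List (DVar N d)) :
    pdl P (Y + Z) = pdl P Y + pdl P Z := by
  induction P with
  | nil => rfl
  | cons a P ih => rw [pdl_cons, ih, pd_add (hY.pdl P) (hZ.pdl P), pdl_cons, pdl_cons]

theorem pdl_zero (P : List (DVar N d)) : pdl P (0 : Fnl N d) = 0 := by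
  induction P with
  | nil => rfl
  | cons a P ih => rw [pdl_cons, ih]; exact (HasPD.const a fun _ => 0).pd_eq

theorem pdl_const (φ : Data N d → ℝ) {P : List (DVar N d)} (hP : P ≠ []) :
    pdl P (fun D _ => φ D) = 0 := by
  obtain ⟨P, a, rfl⟩ := List.eq_nil_or_concat P |>.resolve_left hP
  rw [List.concat_eq_append, pdl_concat, (HasPD.const a φ).pd_eq, pdl_zero]

theorem pdl_sum {κ : Type*} (s : Finset κ) {Y : κ → Fnl N d} (hY : ∀ k ∈ s, Smooth (Y k))
    (P : List (DVar N d)) : pdl P (∑ k ∈ s, Y k) = ∑ k ∈ s, pdl P (Y k) := by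
  classical
  induction s using Finset.induction_on with
  | empty => simpa using pdl_zero P
  | insert k s hk ih =>
    rw [Finset.sum_insert hk, Finset.sum_insert hk, pdl_add (hY k (by simp)), ih]
    · exact fun l hl => hY l (by simp [hl])
    · exact Smooth.sum s fun l hl => hY l (by simp [hl])

/-- The three cases are the three orders of magnitude of a differentiated matrix entry: the entry
itself, the constant 1, and 0. -/
theorem pdl_coord (a : DVar N d) (P : List (DVar N d)) :
    pdl P (coord a) = if P = [] then coord a else if P = [a] then 1 else 0 := by
  induction P using List.reverseRecOn with
  | nil => rfl
  | append_singleton P b ih =>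
    rw [pdl_concat, (HasPD.coord a b).pd_eq]
    rcases eq_or_ne P [] with rfl | h
    · by_cases hab : a = b
      · subst hab; simp; rfl
      · simp [hab, Ne.symm hab]; rfl
    · have : P ++ [b] ≠ [a] := fun hh => h (by
        have := congrArg List.length hh
        simpa using this)
      rw [pdl_const _ h]
      simp [this]

/-- The ways to distribute the elements of a list over two lists. -/
def splits {ι : Type*} : List ι → List (List ι × List ι)
  | [] => [([], [])]
  | a :: P => (splits P).map (fun q => (a :: q.1, q.2)) ++ (splits P).map fun q => (q.1, a :: q.2)

theorem length_splits {ι : Type*} (P : List ι) : (splits P).length = 2 ^ P.length := by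
  induction P with
  | nil => rfl
  | cons a P ih => simp [splits, ih, pow_succ]; ring

theorem coe_of_mem_splits {ι : Type*} {P : List ι} {q : List ι × List ι} (hq : q ∈ splits P) :
    (P : Multiset ι) = (q.1 : Multiset ι) + (q.2 : Multiset ι) := by
  induction P generalizing q with
  | nil => simp only [splits, List.mem_singleton] at hq; subst hq; rfl
  | cons a P ih =>
    simp only [splits, List.mem_append, List.mem_map] at hq
    rw [← Multiset.cons_coe]
    rcases hq with ⟨r, hr, rfl⟩ | ⟨r, hr, rfl⟩
    · rw [ih hr, ← Multiset.cons_coe, Multiset.cons_add]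
    · rw [ih hr, ← Multiset.cons_coe, Multiset.add_cons]

/-- The Leibniz formula. -/
theorem pdl_mul {Y Z : Fnl N d} (hY : Smooth Y) (hZ : Smooth Z) (P : List (DVar N d)) :
    pdl P (Y * Z) = ((splits P).map fun q => pdl q.1 Y * pdl q.2 Z).sum := by
  have key : ∀ (a : DVar N d) (L : List (List (DVar N d) × List (DVar N d))),
      Smooth (L.map fun q => pdl q.1 Y * pdl q.2 Z).sum ∧
      pd a (L.map fun q => pdl q.1 Y * pdl q.2 Z).sum =
        (L.map fun q => pdl (a :: q.1) Y * pdl q.2 Z).sum +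
          (L.map fun q => pdl q.1 Y * pdl (a :: q.2) Z).sum := by
    intro a L
    induction L with
    | nil => exact ⟨Smooth.zero, by
        simp only [List.map_nil, List.sum_nil, add_zero]
        exact (HasPD.const a fun _ => 0).pd_eq⟩
    | cons q L ih =>
      simp only [List.map_cons, List.sum_cons]
      have hq := (hY.pdl q.1).mul (hZ.pdl q.2)
      refine ⟨hq.add ih.1, ?_⟩
      rw [pd_add hq ih.1, ih.2, pd_mul (hY.pdl q.1) (hZ.pdl q.2), pdl_cons, pdl_cons]
      abel
  induction P with
  | nil => simp [splits]
  | cons a P ih =>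
    rw [pdl_cons, ih, (key a _).2]
    simp [splits, List.map_map, Function.comp_def]

/-- The functional obtained by setting the coordinate `a` to zero. -/
def zeroAt (a : DVar N d) (Y : Fnl N d) : Fnl N d := fun D z => Y D (Function.update z a 0)

theorem update_add_smul_single_ne {a b : DVar N d} (hab : b ≠ a) (z : DVar N d → ℝ) (t x : ℝ) :
    Function.update (z + t • (Pi.single b 1 : DVar N d → ℝ)) a x
      = Function.update z a x + t • (Pi.single b 1 : DVar N d → ℝ) := by
  funext c
  by_cases hc : c = a
  · subst hc; simp [hab.symm]
  · simp [hc]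

theorem update_add_smul_single (a : DVar N d) (z : DVar N d → ℝ) (t x : ℝ) :
    Function.update z a x + t • (Pi.single a 1 : DVar N d → ℝ) = Function.update z a (x + t) := by
  funext c
  by_cases hc : c = a
  · subst hc; simp
  · simp [hc]

theorem HasPD.zeroAt_self (a : DVar N d) (Y : Fnl N d) : HasPD a (zeroAt a Y) 0 := fun D z => by
  have : (fun t : ℝ => zeroAt a Y D (z + t • Pi.single a 1)) = fun _ => zeroAt a Y D z := by
    funext t
    unfold zeroAt
    congr 1
    funext c
    by_cases hc : c = a
    · subst hc; simp
    · simp [hc]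
  rw [HasLineDerivAt, this]
  exact hasDerivAt_const _ _

theorem HasPD.zeroAt {a b : DVar N d} (hab : b ≠ a) {Y Y' : Fnl N d} (hY : HasPD b Y Y') :
    HasPD b (zeroAt a Y) (zeroAt a Y') := fun D z => by
  have := hY D (Function.update z a 0)
  simpa only [HasLineDerivAt, GFOM.zeroAt, update_add_smul_single_ne hab] using this

theorem SmoothN.zeroAt (a : DVar N d) :
    ∀ {n : ℕ} {Y : Fnl N d}, SmoothN n Y → SmoothN n (zeroAt a Y) := by
  have hb : ∀ {Y : Fnl N d}, IsBase Y → IsBase (GFOM.zeroAt a Y) := fun {Y} hY =>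
    ⟨fun D x => by unfold GFOM.zeroAt; rw [hY.inv],
      hY.meas.comp (measurable_fst.prodMk ((measurable_update_left (X := fun _ : DVar N d => ℝ)
        (a := a) (x := (0 : ℝ))).comp measurable_snd))⟩
  intro n
  induction n with
  | zero => exact hb
  | succ n ih =>
    intro Y hY
    refine ⟨hb hY.1, fun b => ?_⟩
    by_cases hab : b = a
    · subst hab
      exact ⟨0, HasPD.zeroAt_self b Y, SmoothN.zero n⟩
    · obtain ⟨Y', h₁, h₂⟩ := hY.2 b
      exact ⟨_, h₁.zeroAt hab, ih h₂⟩

theorem Smooth.zeroAt {Y : Fnl N d} (hY : Smooth Y) (a : DVar N d) : Smooth (zeroAt a Y) :=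
  fun n => (hY n).zeroAt a

/-- The restriction `a ∉ P` is essential: after `a` has been frozen at zero, the derivative in `a`
vanishes. -/
theorem pdl_zeroAt {Y : Fnl N d} (hY : Smooth Y) {a : DVar N d} {P : List (DVar N d)}
    (hP : a ∉ P) : pdl P (zeroAt a Y) = zeroAt a (pdl P Y) := by
  induction P with
  | nil => rfl
  | cons b P ih =>
    simp only [List.mem_cons, not_or] at hP
    rw [pdl_cons, ih hP.2, pdl_cons, (((hY.pdl P).hasPD b).zeroAt (Ne.symm hP.1)).pd_eq]

/-- The functional `Y` minus its value with the coordinate `a` set to zero. -/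
def diffAt (a : DVar N d) (Y : Fnl N d) : Fnl N d := Y + (fun _ _ => -1) * zeroAt a Y

theorem Smooth.neg_one : Smooth (fun _ _ => -1 : Fnl N d) :=
  Smooth.const (φ := fun _ => -1) measurable_const fun _ _ => rfl

theorem Smooth.diffAt {Y : Fnl N d} (hY : Smooth Y) (a : DVar N d) : Smooth (diffAt a Y) :=
  hY.add (Smooth.neg_one.mul (hY.zeroAt a))

theorem pdl_neg_one_mul {Y : Fnl N d} (hY : Smooth Y) (P : List (DVar N d)) :
    pdl P ((fun _ _ => -1) * Y) = (fun _ _ => -1) * pdl P Y := by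
  induction P with
  | nil => rfl
  | cons a P ih =>
    rw [pdl_cons, ih, pd_mul Smooth.neg_one (hY.pdl P), (HasPD.const a fun _ => -1).pd_eq, pdl_cons,
      zero_mul, zero_add]

theorem pdl_diffAt {Y : Fnl N d} (hY : Smooth Y) {a : DVar N d} {P : List (DVar N d)}
    (hP : a ∉ P) : pdl P (diffAt a Y) = diffAt a (pdl P Y) := by
  rw [diffAt, pdl_add hY (Smooth.neg_one.mul (hY.zeroAt a)), pdl_neg_one_mul (hY.zeroAt a),
    pdl_zeroAt hY hP]
  rfl

theorem HasPD.hasDerivAt_update {a : DVar N d} {Y Y' : Fnl N d} (hY : HasPD a Y Y')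
    (D : Data N d) (z : DVar N d → ℝ) (x : ℝ) :
    HasDerivAt (fun x => Y D (Function.update z a x)) (Y' D (Function.update z a x)) x := by
  have h := hY D (Function.update z a x)
  simp only [HasLineDerivAt, update_add_smul_single] at h
  have h2 : HasDerivAt (fun t => Y D (Function.update z a (x + (t - x))))
      (Y' D (Function.update z a x)) x := by
    apply HasDerivAt.comp_sub_const (f := fun t => Y D (Function.update z a (x + t)))
    simpa using h
  simpa using h2

/-- Integral formula for the difference operator. -/
theorem diffAt_eq_integral {Y : Fnl N d} (hY : Smooth Y) (a : DVar N d) (D : Data N d)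
    (z : DVar N d → ℝ) :
    diffAt a Y D z = z a * ∫ r in (0 : ℝ)..1, pd a Y D (Function.update z a (r * z a)) := by
  have h₁ : ∀ r : ℝ, HasDerivAt (fun r : ℝ => Y D (Function.update z a (r * z a)))
      (pd a Y D (Function.update z a (r * z a)) * z a) r := fun r => by
    have := ((hY.hasPD a).hasDerivAt_update D z (r * z a)).comp r
      ((hasDerivAt_id r).mul_const (z a))
    rw [one_mul] at this
    exact this
  -- Only partial derivatives are available, but continuity along one coordinate line suffices, and
  -- it follows from the existence of the second derivative in `a`.
  have hc : Continuous fun r : ℝ => pd a Y D (Function.update z a (r * z a)) := by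
    have h₂ : Continuous fun x => pd a Y D (Function.update z a x) :=
      continuous_iff_continuousAt.2 fun x =>
        (((hY.pd a).hasPD a).hasDerivAt_update D z x).continuousAt
    exact h₂.comp (continuous_id.mul continuous_const)
  have := intervalIntegral.integral_eq_sub_of_hasDerivAt (a := (0 : ℝ)) (b := 1)
    (fun r _ => h₁ r) ((hc.mul continuous_const).intervalIntegrable _ _)
  rw [intervalIntegral.integral_mul_const] at this
  rw [mul_comm, this]
  simp [diffAt, zeroAt, sub_eq_add_neg]

end Calculus

-- Hölder, Minkowski and Jensen inequalities for integer moments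

section Norms

variable {Ω : Type*} [MeasurableSpace Ω] {μ : Measure Ω}

theorem eLpNorm_natCast_mul_le {f g : Ω → ℝ} (hf : AEStronglyMeasurable f μ)
    (hg : AEStronglyMeasurable g μ) (p : ℕ) :
    eLpNorm (fun ω => f ω * g ω) p μ ≤ eLpNorm f (2 * p : ℕ) μ * eLpNorm g (2 * p : ℕ) μ := by
  rcases Nat.eq_zero_or_pos p with rfl | hp
  · simp
  have : ENNReal.HolderTriple ((2 * p : ℕ) : ℝ≥0∞) ((2 * p : ℕ) : ℝ≥0∞) (p : ℝ≥0∞) := by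
    refine ⟨?_⟩
    have h2 : ((2 * p : ℕ) : ℝ≥0∞)⁻¹ = 2⁻¹ * (p : ℝ≥0∞)⁻¹ := by
      push_cast
      exact ENNReal.mul_inv (by simp) (by simp)
    rw [h2, ← add_mul, ENNReal.inv_two_add_inv_two, one_mul]
  have h := eLpNorm_smul_le_mul_eLpNorm (p := ((2 * p : ℕ) : ℝ≥0∞)) (q := ((2 * p : ℕ) : ℝ≥0∞))
    (r := (p : ℝ≥0∞)) hg hf
  have heq : (fun ω => f ω * g ω) = f • g := rfl
  rw [heq]
  exact h

theorem eLpNorm_natCast_add_le {f g : Ω → ℝ} (hf : AEStronglyMeasurable f μ)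
    (hg : AEStronglyMeasurable g μ) (p : ℕ) :
    eLpNorm (fun ω => f ω + g ω) p μ ≤ eLpNorm f p μ + eLpNorm g p μ := by
  rcases Nat.eq_zero_or_pos p with rfl | hp
  · simp
  exact eLpNorm_add_le hf hg (by exact_mod_cast hp)

theorem eLpNorm_natCast_sum_le {κ : Type*} (s : Finset κ) {f : κ → Ω → ℝ}
    (hf : ∀ k ∈ s, AEStronglyMeasurable (f k) μ) (p : ℕ) :
    eLpNorm (fun ω => ∑ k ∈ s, f k ω) p μ ≤ ∑ k ∈ s, eLpNorm (f k) p μ := by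
  rcases Nat.eq_zero_or_pos p with rfl | hp
  · simp
  have := eLpNorm_sum_le (p := (p : ℝ≥0∞)) hf (by exact_mod_cast hp)
  convert this using 2
  funext ω
  simp

theorem eLpNorm_natCast_pow {f : Ω → ℝ} {p : ℕ} (hp : p ≠ 0) :
    eLpNorm f p μ ^ p = ∫⁻ ω, ‖f ω‖ₑ ^ p ∂μ := by
  have := eLpNorm_nnreal_pow_eq_lintegral (μ := μ) (f := f) (p := (p : ℝ≥0)) (by exact_mod_cast hp)
  simpa using this

/-- An average over `[0, 1]` of functions has norm at most the supremum of the norms. -/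
theorem eLpNorm_intervalIntegral_le [IsProbabilityMeasure μ] {g : Ω → ℝ → ℝ}
    (hg : Measurable fun q : Ω × ℝ => g q.1 q.2) {p : ℕ} {C : ℝ≥0∞}
    (hC : ∀ r ∈ Set.Icc (0 : ℝ) 1, eLpNorm (fun ω => g ω r) p μ ≤ C) :
    eLpNorm (fun ω => ∫ r in (0 : ℝ)..1, g ω r) p μ ≤ C := by
  rcases Nat.eq_zero_or_pos p with rfl | hp
  · simp
  have hp' := hp.ne'
  let ν : Measure ℝ := volume.restrict (Set.Ioc 0 1)
  have : IsProbabilityMeasure ν := ⟨by simp [ν]⟩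
  rw [← ENNReal.pow_le_pow_left_iff hp', eLpNorm_natCast_pow hp']
  calc ∫⁻ ω, ‖∫ r in (0 : ℝ)..1, g ω r‖ₑ ^ p ∂μ
      ≤ ∫⁻ ω, ∫⁻ r, ‖g ω r‖ₑ ^ p ∂ν ∂μ := by
        refine lintegral_mono fun ω => ?_
        rw [intervalIntegral.integral_of_le zero_le_one, ← eLpNorm_natCast_pow hp']
        gcongr
        -- Jensen on the probability space `[0, 1]`: the `L^1` norm is at most the `L^p` norm.
        -- Tonelli then exchanges the two integrals.
        refine (enorm_integral_le_lintegral_enorm _).trans ?_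
        rw [← eLpNorm_one_eq_lintegral_enorm]
        exact eLpNorm_le_eLpNorm_of_exponent_le (by exact_mod_cast hp)
          (hg.comp measurable_prodMk_left).aestronglyMeasurable
    _ = ∫⁻ r, ∫⁻ ω, ‖g ω r‖ₑ ^ p ∂μ ∂ν := by
        refine lintegral_lintegral_swap ?_
        exact (hg.enorm.pow_const p).aemeasurable
    _ ≤ ∫⁻ _, C ^ p ∂ν := by
        refine setLIntegral_mono measurable_const fun r hr => ?_
        rw [← eLpNorm_natCast_pow hp']
        gcongr
        exact hC r ⟨hr.1.le, hr.2⟩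
    _ = C ^ p := by simp

end Norms

/-- The scale `1 / √N` of the matrix entries. -/
def rN (N : ℕ) : ℝ≥0 := (NNReal.sqrt N)⁻¹

theorem rN_le_one {N : ℕ} (hN : 0 < N) : rN N ≤ 1 := by
  rw [rN]
  refine inv_le_one_of_one_le₀ ?_
  rw [NNReal.one_le_sqrt]
  exact_mod_cast hN

theorem rN_sq (N : ℕ) : rN N ^ 2 = (N : ℝ≥0)⁻¹ := by
  rw [rN, inv_pow, NNReal.sq_sqrt]

-- Random data, stability under rescaling of an entry, and moment bounds for derivatives

section Models

variable {N d : ℕ}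

/-- The coordinate of a matrix entry. -/
def xv (a : Fin N × Fin d) : DVar N d := .X a.1 a.2

theorem xv_injective : Function.Injective (xv : Fin N × Fin d → DVar N d) := by
  rintro ⟨i, j⟩ ⟨i', j'⟩ hh
  simpa [xv] using hh

/-- The data with one matrix entry replaced by `x`. -/
def Data.setX (D : Data N d) (a : Fin N × Fin d) (x : ℝ) : Data N d :=
  D.withX fun i j => if (i, j) = a then x else D.X i j

theorem Data.setX_X (D : Data N d) (a b : Fin N × Fin d) (x : ℝ) :
    (D.setX a x).X b.1 b.2 = if b = a then x else D.X b.1 b.2 := rfl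

theorem Data.setX_setX_self (D : Data N d) (a : Fin N × Fin d) (x y : ℝ) :
    (D.setX a x).setX a y = D.setX a y := by
  simp only [Data.setX, Data.withX]
  congr 1
  funext i j
  split_ifs <;> rfl

theorem Data.setX_setX_comm (D : Data N d) {a b : Fin N × Fin d} (hab : a ≠ b) (x y : ℝ) :
    (D.setX a x).setX b y = (D.setX b y).setX a x := by
  simp only [Data.setX, Data.withX]
  congr 1
  funext i j
  by_cases h1 : (i, j) = a
  · simp [h1, hab]
  · simp [h1]

theorem basePoint_setX (D : Data N d) (a : Fin N × Fin d) (x : ℝ) :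
    basePoint (D.setX a x).X = Function.update (basePoint D.X) (xv a) x := by
  funext c
  rcases c with ⟨i, j⟩ | i | ⟨s, i⟩ | ⟨s, j⟩
  · by_cases h : (i, j) = a
    · subst h; simp [basePoint, Data.setX, Data.withX, xv]
    · have : DVar.X i j ≠ xv a := fun hh => h (xv_injective (a₁ := (i, j)) hh)
      rw [Function.update_of_ne this]
      simp [basePoint, Data.setX, Data.withX, h]
  all_goals
    rw [Function.update_of_ne (by simp [xv])]
    rfl

theorem measurable_data_iff {Ω : Type*} [MeasurableSpace Ω] {D : Ω → Data N d} :
    Measurable D ↔ Measurable fun ω => (D ω).toProd :=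
  measurable_comap_iff

theorem measurable_X : Measurable (fun D : Data N d => D.X) :=
  measurable_fst.comp Data.measurable_toProd

theorem measurable_X_apply (a : Fin N × Fin d) : Measurable (fun D : Data N d => D.X a.1 a.2) :=
  (measurable_pi_apply a.2).comp ((measurable_pi_apply a.1).comp measurable_X)

theorem measurable_θ (j : Fin d) : Measurable (fun D : Data N d => D.θ j) :=
  (measurable_pi_apply j).comp (measurable_fst.comp (measurable_snd.comp Data.measurable_toProd))

theorem measurable_v0 (j : Fin d) : Measurable (fun D : Data N d => D.v0 j) :=
  (measurable_pi_apply j).comp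
    (measurable_fst.comp (measurable_snd.comp (measurable_snd.comp Data.measurable_toProd)))

theorem measurable_w (s : ℕ) (i : Fin N) : Measurable (fun D : Data N d => D.w (s + 1) i) :=
  (measurable_pi_apply i).comp ((measurable_pi_apply s).comp (measurable_fst.comp
    (measurable_snd.comp (measurable_snd.comp (measurable_snd.comp Data.measurable_toProd)))))

theorem measurable_wt (s : ℕ) (j : Fin d) : Measurable (fun D : Data N d => D.wt (s + 1) j) :=
  (measurable_pi_apply j).comp ((measurable_pi_apply s).comp (measurable_snd.comp
    (measurable_snd.comp (measurable_snd.comp (measurable_snd.comp Data.measurable_toProd)))))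

theorem measurable_withX {Ω : Type*} [MeasurableSpace Ω] {D : Ω → Data N d}
    {x : Ω → Fin N → Fin d → ℝ} (hD : Measurable D) (hx : Measurable x) :
    Measurable fun ω => (D ω).withX (x ω) := by
  rw [measurable_data_iff]
  exact hx.prodMk (measurable_snd.comp (Data.measurable_toProd.comp hD))

theorem measurable_setX {Ω : Type*} [MeasurableSpace Ω] {D : Ω → Data N d} (a : Fin N × Fin d)
    {x : Ω → ℝ} (hD : Measurable D) (hx : Measurable x) :
    Measurable fun ω => (D ω).setX a (x ω) := by
  refine measurable_withX hD ?_
  refine measurable_pi_lambda _ fun i => measurable_pi_lambda _ fun j => ?_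
  by_cases h : (i, j) = a
  · simpa [h] using hx
  · simp only [h, if_false]
    exact (measurable_X_apply (i, j)).comp hD

theorem measurable_basePoint : Measurable (fun D : Data N d => basePoint D.X) := by
  refine measurable_pi_lambda _ fun c => ?_
  rcases c with ⟨i, j⟩ | i | ⟨s, i⟩ | ⟨s, j⟩
  · exact measurable_X_apply (i, j)
  all_goals exact measurable_const

/-- The value of a functional at the matrix of the data and at zero external fields. -/
def ev (Y : Fnl N d) (D : Data N d) : ℝ := Y D (basePoint D.X)

theorem IsBase.measurable_ev {Y : Fnl N d} (hY : IsBase Y) : Measurable (ev Y) :=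
  hY.meas.comp (measurable_id.prodMk measurable_basePoint)

theorem Smooth.measurable_ev {Y : Fnl N d} (hY : Smooth Y) : Measurable (ev Y) :=
  hY.isBase.measurable_ev

theorem ev_coord_xv (a : Fin N × Fin d) (D : Data N d) : ev (coord (xv a)) D = D.X a.1 a.2 := rfl

/-- What is used of the random data: an entry of the matrix is centered and independent of the rest
of the data, and all moments are controlled by `K`. -/
structure Model {Ω : Type*} [MeasurableSpace Ω] (K : ℕ → ℝ≥0) (μ : Measure Ω)
    (D : Ω → Data N d) : Prop where
  meas : Measurable D
  indep : ∀ a : Fin N × Fin d,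
    IndepFun (fun ω => (D ω).X a.1 a.2) (fun ω => (D ω).setX a 0) μ
  mean : ∀ a : Fin N × Fin d, ∫ ω, (D ω).X a.1 a.2 ∂μ = 0
  norm_X : ∀ (a : Fin N × Fin d) (p : ℕ),
    eLpNorm (fun ω => (D ω).X a.1 a.2) p μ ≤ (K p * rN N : ℝ≥0)
  norm_θ : ∀ (j : Fin d) (p : ℕ), eLpNorm (fun ω => (D ω).θ j) p μ ≤ K p
  norm_v0 : ∀ (j : Fin d) (p : ℕ), eLpNorm (fun ω => (D ω).v0 j) p μ ≤ K p
  norm_w : ∀ (s : ℕ) (i : Fin N) (p : ℕ), eLpNorm (fun ω => (D ω).w (s + 1) i) p μ ≤ K p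
  norm_wt : ∀ (s : ℕ) (j : Fin d) (p : ℕ), eLpNorm (fun ω => (D ω).wt (s + 1) j) p μ ≤ K p

/-- The data with one matrix entry multiplied by `r`. -/
def Data.scaleX (D : Data N d) (a : Fin N × Fin d) (r : ℝ) : Data N d :=
  D.setX a (r * D.X a.1 a.2)

theorem Data.setX_scaleX (D : Data N d) (a b : Fin N × Fin d) (r : ℝ) :
    (D.scaleX a r).setX b 0 = if b = a then D.setX b 0 else (D.setX b 0).scaleX a r := by
  unfold Data.scaleX
  split_ifs with h
  · subst h
    rw [Data.setX_setX_self]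
  · rw [Data.setX_setX_comm _ (Ne.symm h), Data.setX_X, if_neg (Ne.symm h)]

theorem measurable_scaleX (a : Fin N × Fin d) :
    Measurable fun q : Data N d × ℝ => q.1.scaleX a q.2 :=
  measurable_setX a measurable_fst (measurable_snd.mul ((measurable_X_apply a).comp measurable_fst))

variable {Ω : Type*} [MeasurableSpace Ω] {K : ℕ → ℝ≥0} {μ : Measure Ω}

/-- A factor in `[0, 1]` preserves centering, independence and the moment bounds. The case `r = 0`
sets an entry to zero; the other values are the intermediate points of the integral formula for
`diffAt`. -/
theorem Model.scaleX {D : Ω → Data N d} (hD : Model K μ D) (a : Fin N × Fin d) {r : ℝ}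
    (hr : r ∈ Set.Icc (0 : ℝ) 1) : Model K μ (fun ω => (D ω).scaleX a r) where
  meas := (measurable_scaleX a).comp (hD.meas.prodMk measurable_const)
  indep b := by
    -- The new pair is a measurable image of the old one, component by component: if `b = a` only
    -- the entry is rescaled, otherwise only the remaining data change.
    have hm : Measurable fun x : ℝ => if b = a then r * x else x := by
      split_ifs
      · exact measurable_id.const_mul r
      · exact measurable_id
    have hm' : Measurable fun D : Data N d => if b = a then D else D.scaleX a r := by
      split_ifs
      · exact measurable_id
      · exact (measurable_scaleX a).comp (measurable_id.prodMk measurable_const)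
    have := (hD.indep b).comp hm hm'
    convert this using 1
    · funext ω
      simp only [Data.scaleX, Data.setX_X, Function.comp]
      split_ifs with h
      · rw [h]
      · rfl
    · funext ω
      rw [Data.setX_scaleX]
      rfl
  mean b := by
    simp only [Data.scaleX, Data.setX_X]
    split_ifs with h
    · rw [integral_const_mul, hD.mean, mul_zero]
    · exact hD.mean b
  norm_X b p := by
    simp only [Data.scaleX, Data.setX_X]
    split_ifs with h
    · subst h
      refine le_trans (eLpNorm_mono fun ω => ?_) (hD.norm_X b p)
      rw [norm_mul, Real.norm_of_nonneg hr.1]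
      exact mul_le_of_le_one_left (norm_nonneg _) hr.2
    · exact hD.norm_X b p
  norm_θ := hD.norm_θ
  norm_v0 := hD.norm_v0
  norm_w := hD.norm_w
  norm_wt := hD.norm_wt

/-- Moment bounds for the derivatives of `Y` in the coordinates belonging to `S`. -/
def Bd (K : ℕ → ℝ≥0) (μ : Measure Ω) (Γ : ℕ → ℕ → ℝ≥0) (W : List (DVar N d) → ℝ≥0)
    (S : Set (DVar N d)) (Y : Fnl N d) : Prop :=
  ∀ D : Ω → Data N d, Model K μ D → ∀ P : List (DVar N d), (∀ a ∈ P, a ∈ S) → ∀ p : ℕ,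
    eLpNorm (fun ω => ev (pdl P Y) (D ω)) p μ ≤ (Γ P.length p * W P : ℝ≥0)

theorem Model.aesm {D : Ω → Data N d} (hD : Model K μ D) {Y : Fnl N d} (hY : Smooth Y) :
    AEStronglyMeasurable (fun ω => ev Y (D ω)) μ :=
  (hY.measurable_ev.comp hD.meas).aestronglyMeasurable

/-- Moment bound for the derivative of a product. -/
theorem eLpNorm_pdl_mul_le {D : Ω → Data N d} (hD : Model K μ D) {Y Z : Fnl N d} (hY : Smooth Y)
    (hZ : Smooth Z) (P : List (DVar N d)) (p : ℕ) {C : ℝ≥0∞}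
    (hC : ∀ q ∈ splits P, eLpNorm (fun ω => ev (pdl q.1 Y) (D ω)) (2 * p : ℕ) μ *
      eLpNorm (fun ω => ev (pdl q.2 Z) (D ω)) (2 * p : ℕ) μ ≤ C) :
    eLpNorm (fun ω => ev (pdl P (Y * Z)) (D ω)) p μ ≤ 2 ^ P.length * C := by
  have key : ∀ L : List (List (DVar N d) × List (DVar N d)), (∀ q ∈ L, q ∈ splits P) →
      Smooth (L.map fun q => pdl q.1 Y * pdl q.2 Z).sum ∧
      eLpNorm (fun ω => ev (L.map fun q => pdl q.1 Y * pdl q.2 Z).sum (D ω)) p μ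
        ≤ L.length * C := by
    intro L hL
    induction L with
    | nil => exact ⟨Smooth.zero, by simp [ev]⟩
    | cons q L ih =>
      simp only [List.map_cons, List.sum_cons, List.length_cons]
      obtain ⟨h₁, h₂⟩ := ih fun r hr => hL r (by simp [hr])
      have hq := (hY.pdl q.1).mul (hZ.pdl q.2)
      refine ⟨hq.add h₁, ?_⟩
      refine (eLpNorm_natCast_add_le (hD.aesm hq) (hD.aesm h₁) p).trans ?_
      push_cast
      rw [add_mul, add_comm, one_mul]
      refine add_le_add h₂ ?_
      exact (eLpNorm_natCast_mul_le (hD.aesm (hY.pdl q.1)) (hD.aesm (hZ.pdl q.2)) p).trans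
        (hC q (hL q (by simp)))
  rw [pdl_mul hY hZ]
  refine (key _ fun _ h => h).2.trans ?_
  rw [length_splits]
  simp

/-- The constants in the product rule. -/
def mulConst (Γ Γ' : ℕ → ℕ → ℝ≥0) (m p : ℕ) : ℝ≥0 :=
  2 ^ m * ∑ k ∈ Finset.range (m + 1), ∑ l ∈ Finset.range (m + 1), Γ k (2 * p) * Γ' l (2 * p)

theorem eLpNorm_pdl_mul_le_mulConst {Γ Γ' : ℕ → ℕ → ℝ≥0} {W W' : List (DVar N d) → ℝ≥0} {B : ℝ≥0}
    {D : Ω → Data N d} (hD : Model K μ D) {Y Z : Fnl N d} (hYs : Smooth Y) (hZs : Smooth Z)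
    {P : List (DVar N d)} {p : ℕ}
    (hY : ∀ q ∈ splits P, eLpNorm (fun ω => ev (pdl q.1 Y) (D ω)) (2 * p : ℕ) μ
      ≤ (Γ q.1.length (2 * p) * W q.1 : ℝ≥0))
    (hZ : ∀ q ∈ splits P, eLpNorm (fun ω => ev (pdl q.2 Z) (D ω)) (2 * p : ℕ) μ
      ≤ (Γ' q.2.length (2 * p) * W' q.2 : ℝ≥0))
    (hW : ∀ q ∈ splits P, W q.1 * W' q.2 ≤ B) :
    eLpNorm (fun ω => ev (pdl P (Y * Z)) (D ω)) p μ ≤ (mulConst Γ Γ' P.length p * B : ℝ≥0) := by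
  rw [mulConst]
  have : ((2 ^ P.length * (∑ k ∈ Finset.range (P.length + 1), ∑ l ∈ Finset.range (P.length + 1),
      Γ k (2 * p) * Γ' l (2 * p)) * B : ℝ≥0) : ℝ≥0∞) = 2 ^ P.length *
      (((∑ k ∈ Finset.range (P.length + 1), ∑ l ∈ Finset.range (P.length + 1),
      Γ k (2 * p) * Γ' l (2 * p)) * B : ℝ≥0) : ℝ≥0∞) := by
    rw [mul_assoc, ENNReal.coe_mul]
    simp
  rw [this]
  refine eLpNorm_pdl_mul_le hD hYs hZs P p fun q hq => ?_
  have hlen : P.length = q.1.length + q.2.length := by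
    simpa using congrArg Multiset.card (coe_of_mem_splits hq)
  refine (mul_le_mul' (hY q hq) (hZ q hq)).trans ?_
  rw [← ENNReal.coe_mul, ENNReal.coe_le_coe, mul_mul_mul_comm]
  refine mul_le_mul' ?_ (hW q hq)
  have h1 : q.1.length ∈ Finset.range (P.length + 1) := by simp; omega
  have h2 : q.2.length ∈ Finset.range (P.length + 1) := by simp; omega
  exact (Finset.single_le_sum (f := fun l => Γ q.1.length (2 * p) * Γ' l (2 * p))
    (fun _ _ => zero_le) h2).trans
    (Finset.single_le_sum (f := fun k => ∑ l ∈ Finset.range (P.length + 1),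
      Γ k (2 * p) * Γ' l (2 * p)) (fun _ _ => zero_le) h1)

/-- Each factor is needed at twice the moment, by Cauchy–Schwarz. The weights enter only through
their product over all splittings of `P`. -/
theorem Bd.mul {Γ Γ' : ℕ → ℕ → ℝ≥0} {W W' W'' : List (DVar N d) → ℝ≥0} {S : Set (DVar N d)}
    {Y Z : Fnl N d} (hYs : Smooth Y) (hZs : Smooth Z) (hY : Bd K μ Γ W S Y) (hZ : Bd K μ Γ' W' S Z)
    (hW : ∀ P : List (DVar N d), (∀ a ∈ P, a ∈ S) → ∀ q ∈ splits P, W q.1 * W' q.2 ≤ W'' P) :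
    Bd K μ (mulConst Γ Γ') W'' S (Y * Z) := by
  intro D hD P hP p
  have hmem : ∀ q ∈ splits P, ∀ a, a ∈ P ↔ a ∈ q.1 ∨ a ∈ q.2 := fun q hq a => by
    rw [← Multiset.mem_coe, coe_of_mem_splits hq, Multiset.mem_add, Multiset.mem_coe,
      Multiset.mem_coe]
  exact eLpNorm_pdl_mul_le_mulConst hD hYs hZs
    (fun q hq => hY D hD q.1 (fun a ha => hP a ((hmem q hq a).2 (Or.inl ha))) (2 * p))
    (fun q hq => hZ D hD q.2 (fun a ha => hP a ((hmem q hq a).2 (Or.inr ha))) (2 * p)) (hW P hP)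

/-- This is the purpose of `IsBase.inv`: since the matrix enters only through `z`, moving the
evaluation point is the same as changing the random data, so bounds valid in all models apply. -/
theorem ev_update {Y : Fnl N d} (hY : IsBase Y) (a : Fin N × Fin d) (D : Data N d) (x : ℝ) :
    Y D (Function.update (basePoint D.X) (xv a) x) = ev Y (D.setX a x) := by
  rw [ev, basePoint_setX, Data.setX, hY.inv]

theorem ev_zeroAt {Y : Fnl N d} (hY : IsBase Y) (a : Fin N × Fin d) (D : Data N d) :
    ev (zeroAt (xv a) Y) D = ev Y (D.setX a 0) := ev_update hY a D 0

/-- The difference operator gains a factor `1 / √N`. -/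
theorem Bd.diffAt [IsProbabilityMeasure μ] {Γ : ℕ → ℕ → ℝ≥0} {ε : ℝ≥0} {S : Set (DVar N d)}
    {Y : Fnl N d} (hYs : Smooth Y) (hY : Bd K μ Γ (fun _ => ε) S Y) {a : Fin N × Fin d}
    (ha : xv a ∈ S) :
    Bd K μ (fun m p => K (2 * p) * Γ (m + 1) (2 * p)) (fun _ => rN N * ε) (S \ {xv a})
      (diffAt (xv a) Y) := by
  intro D hD P hP p
  have haP : xv a ∉ P := fun h => (hP _ h).2 rfl
  have hsm : Smooth (pdl (xv a :: P) Y) := hYs.pdl _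
  rw [pdl_diffAt hYs haP]
  -- The entry supplies the factor `1/√N`; the averaged derivative is evaluated in the rescaled
  -- models, where the hypothesis on `Y` applies with one more derivative.
  have heq : (fun ω => ev (GFOM.diffAt (xv a) (pdl P Y)) (D ω)) = fun ω => (D ω).X a.1 a.2 *
      ∫ r in (0 : ℝ)..1, ev (pdl (xv a :: P) Y) ((D ω).scaleX a r) := by
    funext ω
    rw [ev, diffAt_eq_integral (hYs.pdl P)]
    congr 1
    refine intervalIntegral.integral_congr fun r _ => ?_
    exact ev_update hsm.isBase a (D ω) _
  have hme : Measurable fun q : Ω × ℝ => ev (pdl (xv a :: P) Y) ((D q.1).scaleX a q.2) :=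
    hsm.measurable_ev.comp ((measurable_scaleX a).comp
      ((hD.meas.comp measurable_fst).prodMk measurable_snd))
  rw [heq]
  refine (eLpNorm_natCast_mul_le ((measurable_X_apply a).comp hD.meas).aestronglyMeasurable
    ?_ p).trans ?_
  · simp only [intervalIntegral.integral_of_le zero_le_one]
    exact hme.stronglyMeasurable.integral_prod_right.aestronglyMeasurable
  · refine (mul_le_mul' (hD.norm_X a (2 * p)) (eLpNorm_intervalIntegral_le hme fun r hr =>
      hY _ (hD.scaleX a hr) (xv a :: P) ?_ (2 * p))).trans ?_
    · intro b hb
      rcases List.mem_cons.1 hb with rfl | hb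
      · exact ha
      · exact (hP b hb).1
    · rw [← ENNReal.coe_mul, ENNReal.coe_le_coe, List.length_cons]
      exact le_of_eq (by ring)

end Models

-- Counting tuples by the number of distinct values

section Counting

/-- The sum of `N^{-|f(Fin q)|}` over all `q`-tuples `f` from a set of size at most `c N`. -/
theorem sum_inv_pow_card_image_le {T : Type*} [Fintype T] [DecidableEq T] {N c : ℕ} (hN : 0 < N)
    (hT : Fintype.card T ≤ c * N) (q : ℕ) :
    ∑ f : Fin q → T, ((N : ℝ≥0)⁻¹) ^ (Finset.univ.image f).card
      ≤ ∏ l ∈ Finset.range q, ((l : ℝ≥0) + c) := by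
  induction q with
  | zero => simp
  | succ q ih =>
    have hN' : (N : ℝ≥0) ≠ 0 := by exact_mod_cast hN.ne'
    rw [← (Fin.consEquiv fun _ : Fin (q + 1) => T).sum_comp, Fintype.sum_prod_type_right,
      Finset.prod_range_succ, mul_comm _ ((q : ℝ≥0) + c)]
    refine le_trans ?_ (mul_le_mul_right ih _)
    rw [Finset.mul_sum]
    refine Finset.sum_le_sum fun f _ => ?_
    set I := Finset.univ.image f with hI
    have himg : ∀ x : T, Finset.univ.image (Fin.cons x f : Fin (q + 1) → T) = insert x I := by
      intro x
      ext y
      simp [hI, Fin.exists_fin_succ, eq_comm]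
    -- Prepending `x` costs nothing if `x` is already a value of `f`, which happens for at most `q`
    -- choices. Otherwise it costs `1/N`, for at most `c N` choices. Together they give the factor
    -- `q + c`.
    have hle : ∀ x : T, ((N : ℝ≥0)⁻¹) ^ (Finset.univ.image (Fin.cons x f : Fin (q + 1) → T)).card
        ≤ ((if x ∈ I then 1 else 0) + (N : ℝ≥0)⁻¹) * ((N : ℝ≥0)⁻¹) ^ I.card := by
      intro x
      rw [himg]
      by_cases hx : x ∈ I
      · rw [Finset.insert_eq_of_mem hx, if_pos hx]
        exact le_mul_of_one_le_left zero_le (le_add_of_nonneg_right zero_le)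
      · rw [Finset.card_insert_of_notMem hx, if_neg hx, zero_add, pow_succ, mul_comm]
    refine (Finset.sum_le_sum fun x _ => hle x).trans ?_
    rw [← Finset.sum_mul]
    refine mul_le_mul_left ?_ _
    rw [Finset.sum_add_distrib]
    refine add_le_add ?_ ?_
    · simp only [Finset.sum_ite_mem, Finset.univ_inter, Finset.sum_const, nsmul_eq_mul, mul_one]
      have : I.card ≤ q := by
        simpa using (Finset.card_image_le (s := (Finset.univ : Finset (Fin q))) (f := f))
      exact_mod_cast this
    · rw [Finset.sum_const, Finset.card_univ, nsmul_eq_mul, ← div_eq_mul_inv,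
        div_le_iff₀ (by positivity)]
      exact_mod_cast hT

/-- The values that a tuple takes exactly once. -/
def onceHit {T : Type*} [DecidableEq T] {q : ℕ} (f : Fin q → T) : Finset T :=
  (Finset.univ.image f).filter fun a => (Finset.univ.filter fun l => f l = a).card = 1

/-- Sum over the values `a` the inequality `2 ≤ mult(a) + 1[mult(a) = 1]`, using that the
multiplicities add up to `q`. -/
theorem two_mul_card_image_le {T : Type*} [DecidableEq T] {q : ℕ} (f : Fin q → T) :
    2 * (Finset.univ.image f).card ≤ q + (onceHit f).card := by
  have h := Finset.card_eq_sum_card_image f (Finset.univ : Finset (Fin q))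
  rw [Finset.card_univ, Fintype.card_fin] at h
  rw [onceHit, Finset.card_filter]
  refine le_trans ?_ (add_le_add_left h.ge _)
  rw [← Finset.sum_add_distrib, mul_comm, ← smul_eq_mul]
  refine Finset.card_nsmul_le_sum _ _ _ fun a ha => ?_
  have hpos : 0 < (Finset.univ.filter fun l => f l = a).card := by
    obtain ⟨l, -, hl⟩ := Finset.mem_image.1 ha
    exact Finset.card_pos.2 ⟨l, by simp [hl]⟩
  split_ifs <;> omega

theorem card_onceHit_le {T : Type*} [DecidableEq T] {q : ℕ} (f : Fin q → T) :
    (onceHit f).card ≤ q :=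
  (Finset.card_filter_le _ _).trans (by
    simpa using (Finset.card_image_le (s := (Finset.univ : Finset (Fin q))) (f := f)))

theorem exists_of_mem_onceHit {T : Type*} [DecidableEq T] {q : ℕ} {f : Fin q → T} {a : T}
    (ha : a ∈ onceHit f) : ∃ l, f l = a ∧ ∀ l', l' ≠ l → f l' ≠ a := by
  obtain ⟨l, hl⟩ := Finset.card_eq_one.1 (Finset.mem_filter.1 ha).2
  have h : ∀ l', f l' = a ↔ l' = l := fun l' => by
    have : l' ∈ (Finset.univ.filter fun l => f l = a) ↔ l' ∈ ({l} : Finset (Fin q)) := by rw [hl]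
    simpa using this
  exact ⟨l, (h l).2 rfl, fun l' hl' h' => hl' ((h l').1 h')⟩

end Counting

-- Moments of sums of matrix entries with dependent weights

section Core

variable {N d : ℕ} {Ω : Type*} [MeasurableSpace Ω] {K : ℕ → ℝ≥0} {μ : Measure Ω}

/-- The constants for a product of `q` factors. -/
def prodConst (Γ : ℕ → ℕ → ℝ≥0) : ℕ → ℕ → ℕ → ℝ≥0
  | 0 => fun _ _ => 1
  | q + 1 => mulConst Γ (prodConst Γ q)

theorem Bd.prod [IsProbabilityMeasure μ] {Γ : ℕ → ℕ → ℝ≥0} {ε : ℝ≥0} {S : Set (DVar N d)} :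
    ∀ {q : ℕ} {A : Fin q → Fnl N d}, (∀ l, Smooth (A l)) →
      (∀ l, Bd K μ Γ (fun _ => ε) S (A l)) →
      Bd K μ (prodConst Γ q) (fun _ => ε ^ q) S (∏ l, A l)
  | 0, A, _, _ => by
    intro D hD P _ p
    rw [Finset.univ_eq_empty, Finset.prod_empty]
    simp only [prodConst, pow_zero, mul_one, ENNReal.coe_one]
    rcases eq_or_ne P [] with rfl | hP
    · refine (eLpNorm_le_of_ae_bound (C := 1) (Filter.Eventually.of_forall fun ω => ?_)).trans ?_
      · simp [ev]
      · simp
    · have : pdl P (1 : Fnl N d) = 0 := pdl_const (fun _ => 1) hP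
      rw [this]
      simp [ev]
  | q + 1, A, hs, hb => by
    rw [Fin.prod_univ_succ]
    refine Bd.mul (hs 0) (Smooth.prod _ fun l _ => hs _) (hb 0)
      (Bd.prod (fun l => hs l.succ) fun l => hb l.succ) fun P _ r _ => ?_
    rw [pow_succ, mul_comm]

theorem Bd.coord_xv (a : Fin N × Fin d) :
    Bd K μ (fun _ p => K p) (fun _ => rN N) ∅ (coord (xv a)) := by
  intro D hD P hP p
  have : P = [] := List.eq_nil_iff_forall_not_mem.2 fun b hb => hP b hb
  subst this
  exact hD.norm_X a p

/-- The iterated difference operator. -/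
def diffList (L : List (Fin N × Fin d)) (Y : Fnl N d) : Fnl N d :=
  L.foldr (fun a Z => diffAt (xv a) Z) Y

theorem Smooth.diffList {Y : Fnl N d} (hY : Smooth Y) :
    ∀ L : List (Fin N × Fin d), Smooth (diffList L Y)
  | [] => hY
  | a :: L => (Smooth.diffList hY L).diffAt (xv a)

/-- The constants for the iterated difference operator. -/
def diffConst (K : ℕ → ℝ≥0) (Γ : ℕ → ℕ → ℝ≥0) : ℕ → ℕ → ℕ → ℝ≥0
  | 0 => Γ
  | n + 1 => fun m p => K (2 * p) * diffConst K Γ n (m + 1) (2 * p)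

/-- Each difference gains `1/√N` and spends one derivative and a doubling of the moment. The entries
must be distinct, because a difference operator commutes only with derivatives in other coordinates;
this is also why they leave the admissible set. -/
theorem Bd.diffList [IsProbabilityMeasure μ] {Γ : ℕ → ℕ → ℝ≥0} {ε : ℝ≥0} {S : Set (DVar N d)}
    {Y : Fnl N d} (hYs : Smooth Y) (hY : Bd K μ Γ (fun _ => ε) S Y) :
    ∀ {L : List (Fin N × Fin d)}, L.Nodup → (∀ a ∈ L, xv a ∈ S) →
      Bd K μ (diffConst K Γ L.length) (fun _ => rN N ^ L.length * ε) (S \ {b | ∃ a ∈ L, b = xv a})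
        (diffList L Y)
  | [], _, _ => by simpa [diffConst, GFOM.diffList] using hY
  | a :: L, hL, hLS => by
    have ih := Bd.diffList hYs hY (L := L) (List.nodup_cons.1 hL).2
      fun b hb => hLS b (by simp [hb])
    have ha : xv a ∈ S \ {b | ∃ a ∈ L, b = xv a} := by
      refine ⟨hLS a (by simp), ?_⟩
      rintro ⟨b, hb, hab⟩
      rw [xv_injective hab] at hL
      exact (List.nodup_cons.1 hL).1 hb
    have := ih.diffAt (hYs.diffList L) ha
    intro D hD P hP p
    refine (this D hD P (fun b hb => ?_) p).trans (le_of_eq ?_)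
    · have h := hP b hb
      refine ⟨⟨h.1, ?_⟩, ?_⟩
      · rintro ⟨c, hc, rfl⟩
        exact h.2 ⟨c, by simp [hc], rfl⟩
      · rintro rfl
        exact h.2 ⟨a, by simp, rfl⟩
    · simp only [diffConst, List.length_cons, pow_succ]
      congr 1
      ring

/-- All moments of a functional are finite in every model. -/
def Mom (K : ℕ → ℝ≥0) (μ : Measure Ω) (Y : Fnl N d) : Prop :=
  ∀ D : Ω → Data N d, Model K μ D → ∀ p : ℕ, eLpNorm (fun ω => ev Y (D ω)) p μ < ⊤

theorem Bd.mom {Γ : ℕ → ℕ → ℝ≥0} {W : List (DVar N d) → ℝ≥0} {S : Set (DVar N d)} {Y : Fnl N d}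
    (hY : Bd K μ Γ W S Y) : Mom K μ Y := fun D hD p =>
  (hY D hD [] (by simp) p).trans_lt ENNReal.coe_lt_top

theorem Mom.integrable_mul {Y Z : Fnl N d} (hYs : Smooth Y) (hZs : Smooth Z)
    (hY : Mom K μ Y) (hZ : Mom K μ Z) {D D' : Ω → Data N d} (hD : Model K μ D)
    (hD' : Model K μ D') : Integrable (fun ω => ev Y (D ω) * ev Z (D' ω)) μ := by
  rw [← memLp_one_iff_integrable]
  refine ⟨(hD.aesm hYs).mul (hD'.aesm hZs), ?_⟩
  have h := eLpNorm_natCast_mul_le (hD.aesm hYs) (hD'.aesm hZs) 1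
  rw [Nat.cast_one] at h
  exact h.trans_lt (ENNReal.mul_lt_top (hY D hD _) (hZ D' hD' _))

theorem Mom.zeroAt {Y : Fnl N d} (hYs : Smooth Y) (hY : Mom K μ Y) (a : Fin N × Fin d) :
    Mom K μ (zeroAt (xv a) Y) := fun D hD p => by
  -- Setting an entry to zero gives another model, so nothing new has to be bounded.
  have := hY _ (hD.scaleX a (r := 0) ⟨le_rfl, zero_le_one⟩) p
  simpa only [ev_zeroAt hYs.isBase, Data.scaleX, zero_mul] using this

theorem Mom.diffAt {Y : Fnl N d} (hYs : Smooth Y) (hY : Mom K μ Y) (a : Fin N × Fin d) :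
    Mom K μ (diffAt (xv a) Y) := fun D hD p => by
  have h := eLpNorm_natCast_add_le (hD.aesm hYs) ((hD.aesm (hYs.zeroAt (xv a))).neg) p
  rw [eLpNorm_neg] at h
  refine lt_of_le_of_lt (le_of_eq ?_) (h.trans_lt (ENNReal.add_lt_top.2
    ⟨hY D hD p, Mom.zeroAt hYs hY a D hD p⟩))
  congr 1
  funext ω
  simp [ev, GFOM.diffAt]

theorem ev_prod {κ : Type*} (s : Finset κ) (A : κ → Fnl N d) (D : Data N d) :
    ev (∏ k ∈ s, A k) D = ∏ k ∈ s, ev (A k) D := by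
  simp [ev, Finset.prod_apply]

/-- The entry `f l` occurs exactly once in the monomial. In the term with `Ψ` frozen at zero in this
entry, it is multiplied by a quantity independent of it, so that term has zero mean and may be
subtracted at will. -/
theorem integral_mul_diffAt {q : ℕ} {f : Fin q → Fin N × Fin d} {l : Fin q}
    (hl : ∀ l', l' ≠ l → f l' ≠ f l) {Ψ : Fnl N d} (hΨs : Smooth Ψ) (hΨ : Mom K μ Ψ)
    (hM : Mom K μ (∏ l, coord (xv (f l)) : Fnl N d)) {D : Ω → Data N d} (hD : Model K μ D) :
    ∫ ω, ev (∏ l, coord (xv (f l))) (D ω) * ev (diffAt (xv (f l)) Ψ) (D ω) ∂μ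
      = ∫ ω, ev (∏ l, coord (xv (f l))) (D ω) * ev Ψ (D ω) ∂μ := by
  set M : Fnl N d := ∏ l, coord (xv (f l)) with hMdef
  have hMs : Smooth M := Smooth.prod _ fun k _ => Smooth.coord _
  have hzero : ∫ ω, ev M (D ω) * ev (zeroAt (xv (f l)) Ψ) (D ω) ∂μ = 0 := by
    set M' : Fnl N d := ∏ k ∈ Finset.univ.erase l, coord (xv (f k)) with hM'def
    have hM's : Smooth M' := Smooth.prod _ fun k _ => Smooth.coord _
    -- The monomial without the factor `l` does not see the entry `f l`, precisely because no other
    -- index has this value.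
    have hM' : ∀ D : Data N d, ev M' (D.setX (f l) 0) = ev M' D := fun D => by
      rw [hM'def, ev_prod, ev_prod]
      refine Finset.prod_congr rfl fun k hk => ?_
      rw [ev_coord_xv, ev_coord_xv, Data.setX_X, if_neg (hl k (Finset.ne_of_mem_erase hk))]
    have heq : ∀ ω, ev M (D ω) * ev (zeroAt (xv (f l)) Ψ) (D ω) = (D ω).X (f l).1 (f l).2 *
        (ev M' ((D ω).setX (f l) 0) * ev Ψ ((D ω).setX (f l) 0)) := fun ω => by
      rw [ev_zeroAt hΨs.isBase, hM', ← mul_assoc, hMdef, ev_prod, hM'def, ev_prod,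
        ← Finset.mul_prod_erase _ _ (Finset.mem_univ l), ev_coord_xv]
    simp only [heq]
    have hmeas : Measurable fun D : Data N d => ev M' D * ev Ψ D :=
      hM's.measurable_ev.mul hΨs.measurable_ev
    have hind := (hD.indep (f l)).comp measurable_id hmeas
    have h := hind.integral_fun_mul_eq_mul_integral
      ((measurable_X_apply (f l)).comp hD.meas).aestronglyMeasurable
      (hmeas.comp (measurable_setX (f l) hD.meas measurable_const)).aestronglyMeasurable
    simp only [Function.comp, id] at h
    rw [h, hD.mean, zero_mul]
  have hsplit : ∀ ω, ev M (D ω) * ev (diffAt (xv (f l)) Ψ) (D ω)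
      = ev M (D ω) * ev Ψ (D ω) - ev M (D ω) * ev (zeroAt (xv (f l)) Ψ) (D ω) := fun ω => by
    simp only [ev, diffAt, Pi.add_apply, Pi.mul_apply]
    ring
  simp only [hsplit]
  rw [integral_sub (Mom.integrable_mul hMs hΨs hM hΨ hD hD)
    (Mom.integrable_mul hMs (hΨs.zeroAt _) hM (hΨ.zeroAt hΨs _) hD hD), hzero, sub_zero]

theorem integral_mul_diffList {q : ℕ} {f : Fin q → Fin N × Fin d} {Φ : Fnl N d} (hΦs : Smooth Φ)
    (hΦ : Mom K μ Φ) (hM : Mom K μ (∏ l, coord (xv (f l)) : Fnl N d)) {D : Ω → Data N d}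
    (hD : Model K μ D) {L : List (Fin N × Fin d)}
    (hL : ∀ a ∈ L, ∃ l, f l = a ∧ ∀ l', l' ≠ l → f l' ≠ a) :
    Mom K μ (diffList L Φ) ∧
    ∫ ω, ev (∏ l, coord (xv (f l))) (D ω) * ev (diffList L Φ) (D ω) ∂μ
      = ∫ ω, ev (∏ l, coord (xv (f l))) (D ω) * ev Φ (D ω) ∂μ := by
  induction L with
  | nil => exact ⟨hΦ, rfl⟩
  | cons a L ih =>
    obtain ⟨h₁, h₂⟩ := ih fun b hb => hL b (by simp [hb])
    obtain ⟨l, rfl, hl⟩ := hL a (by simp)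
    exact ⟨h₁.diffAt (hΦs.diffList L) _,
      (integral_mul_diffAt hl (hΦs.diffList L) h₁ hM hD).trans h₂⟩

/-- The constant in the bound of a mixed moment. -/
def mixedConst (K : ℕ → ℝ≥0) (Γ : ℕ → ℕ → ℝ≥0) (q : ℕ) : ℝ≥0 :=
  prodConst (fun _ p => K p) q 0 2 *
    ∑ n ∈ Finset.range (q + 1), diffConst K (prodConst Γ q) n 0 2

/-- The `q` entries themselves give `rN ^ q`, and one difference for each entry that occurs once
gives `rN ^ (onceHit f).card`. Cauchy–Schwarz separates the monomial from the differences, whence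
the second moments in `mixedConst`. -/
theorem enorm_integral_mixed_le [IsProbabilityMeasure μ] {Γ : ℕ → ℕ → ℝ≥0} {ε : ℝ≥0}
    {S : Set (DVar N d)} {q : ℕ} {f : Fin q → Fin N × Fin d} {A : Fin q → Fnl N d}
    (hf : ∀ l, xv (f l) ∈ S) (hs : ∀ l, Smooth (A l)) (hb : ∀ l, Bd K μ Γ (fun _ => ε) S (A l))
    {D : Ω → Data N d} (hD : Model K μ D) :
    ‖∫ ω, ∏ l, ((D ω).X (f l).1 (f l).2 * ev (A l) (D ω)) ∂μ‖ₑ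
      ≤ (mixedConst K Γ q * (ε ^ q * rN N ^ (q + (onceHit f).card)) : ℝ≥0) := by
  set M : Fnl N d := ∏ l, coord (xv (f l)) with hMdef
  set Φ : Fnl N d := ∏ l, A l with hΦdef
  have hMs : Smooth M := Smooth.prod _ fun k _ => Smooth.coord _
  have hΦs : Smooth Φ := Smooth.prod _ fun k _ => hs k
  have hMb : Bd K μ _ _ ∅ M := Bd.prod (fun l => Smooth.coord (xv (f l)))
    fun l => Bd.coord_xv (f l)
  have hΦb : Bd K μ _ _ S Φ := Bd.prod hs hb
  set L := (onceHit f).toList with hLdef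
  have hL := integral_mul_diffList hΦs hΦb.mom hMb.mom hD (f := f) (L := L) fun a ha =>
    exists_of_mem_onceHit (by simpa [hLdef] using ha)
  have hΔs : Smooth (diffList L Φ) := hΦs.diffList L
  have hΔb := hΦb.diffList hΦs (L := L) (Finset.nodup_toList _) (fun a ha => by
    obtain ⟨l, rfl, -⟩ := exists_of_mem_onceHit (f := f) (a := a) (by simpa [hLdef] using ha)
    exact hf l)
  have heq : ∫ ω, ∏ l, ((D ω).X (f l).1 (f l).2 * ev (A l) (D ω)) ∂μ
      = ∫ ω, ev M (D ω) * ev (diffList L Φ) (D ω) ∂μ := by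
    rw [hL.2]
    refine integral_congr_ae (Filter.Eventually.of_forall fun ω => ?_)
    simp only [hΦdef, ev_prod, Finset.prod_mul_distrib, ev_coord_xv]
  rw [heq]
  refine (enorm_integral_le_lintegral_enorm _).trans ?_
  rw [← eLpNorm_one_eq_lintegral_enorm]
  have h := eLpNorm_natCast_mul_le (hD.aesm hMs) (hD.aesm hΔs) 1
  rw [Nat.cast_one] at h
  refine h.trans ((mul_le_mul' (hMb D hD [] (by simp) _) (hΔb D hD [] (by simp) _)).trans ?_)
  rw [← ENNReal.coe_mul, ENNReal.coe_le_coe]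
  have hlen : L.length = (onceHit f).card := Finset.length_toList _
  rw [hlen]
  have hle : diffConst K (prodConst Γ q) (onceHit f).card 0 2 ≤
      ∑ n ∈ Finset.range (q + 1), diffConst K (prodConst Γ q) n 0 2 :=
    Finset.single_le_sum (f := fun n => diffConst K (prodConst Γ q) n 0 2) (fun _ _ => zero_le)
      (by have := card_onceHit_le f; simp; omega)
  rw [mixedConst]
  calc _ = prodConst (fun _ p => K p) q 0 2 * diffConst K (prodConst Γ q) (onceHit f).card 0 2 *
        (ε ^ q * rN N ^ (q + (onceHit f).card)) := by
        simp only [List.length_nil, mul_one]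
        rw [pow_add]
        ring
    _ ≤ _ := by gcongr

/-- The constant in the bound of a sum of matrix entries with weights. -/
def sumConst (K : ℕ → ℝ≥0) (c : ℕ) (Γ : ℕ → ℕ → ℝ≥0) (p : ℕ) : ℝ≥0 :=
  1 + mixedConst K Γ (2 * p) * ∏ l ∈ Finset.range (2 * p), ((l : ℝ≥0) + c)

/-- A sum of `O(N)` matrix entries, weighted with functionals whose derivatives in these entries
are of order `ε`, is of order `ε`. -/
theorem eLpNorm_sum_entries_le [IsProbabilityMeasure μ] {c : ℕ} (hN : 0 < N)
    {Γ : ℕ → ℕ → ℝ≥0} {ε : ℝ≥0} {T : Finset (Fin N × Fin d)} (hT : T.card ≤ c * N)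
    {A : Fin N × Fin d → Fnl N d} (hs : ∀ a ∈ T, Smooth (A a))
    (hb : ∀ a ∈ T, Bd K μ Γ (fun _ => ε) {b | ∃ a ∈ T, b = xv a} (A a))
    {D : Ω → Data N d} (hD : Model K μ D) (p : ℕ) :
    eLpNorm (fun ω => ∑ a ∈ T, (D ω).X a.1 a.2 * ev (A a) (D ω)) p μ
      ≤ (sumConst K c Γ p * ε : ℝ≥0) := by
  rcases Nat.eq_zero_or_pos p with rfl | hp
  · simp
  have hXm : ∀ a : Fin N × Fin d, AEStronglyMeasurable (fun ω => (D ω).X a.1 a.2) μ := fun a =>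
    ((measurable_X_apply a).comp hD.meas).aestronglyMeasurable
  -- An even exponent removes the absolute value, so that the power can be expanded and the signs
  -- exploited.
  set q := 2 * p with hq
  have hq0 : q ≠ 0 := by omega
  have hpq : (p : ℝ≥0∞) ≤ (q : ℝ≥0∞) := by exact_mod_cast (by omega : p ≤ q)
  refine (eLpNorm_le_eLpNorm_of_exponent_le hpq ?_).trans ?_
  · exact Finset.aestronglyMeasurable_fun_sum _ fun a ha => (hXm a).mul (hD.aesm (hs a ha))
  rw [← ENNReal.pow_le_pow_left_iff hq0, eLpNorm_natCast_pow hq0]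
  have hexp : ∀ ω, (∑ a ∈ T, (D ω).X a.1 a.2 * ev (A a) (D ω)) ^ q = ∑ f : Fin q → T,
      ∏ l, ((D ω).X (f l).1.1 (f l).1.2 * ev (A (f l)) (D ω)) := fun ω => by
    rw [← Finset.sum_coe_sort, Fintype.sum_pow]
  have hint : ∀ f : Fin q → T,
      Integrable (fun ω => ∏ l, ((D ω).X (f l).1.1 (f l).1.2 * ev (A (f l)) (D ω))) μ := by
    intro f
    have hMb := Bd.prod (K := K) (μ := μ) (fun l => Smooth.coord (xv (f l).1))
      fun l => Bd.coord_xv (f l).1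
    have hΦb := Bd.prod (A := fun l => A (f l).1) (fun l => hs _ (f l).2) fun l => hb _ (f l).2
    have := Mom.integrable_mul (Smooth.prod _ fun k _ => Smooth.coord _)
      (Smooth.prod _ fun k _ => hs _ (f k).2) hMb.mom hΦb.mom hD hD
    refine this.congr (Filter.Eventually.of_forall fun ω => ?_)
    simp only [ev_prod, Finset.prod_mul_distrib, ev_coord_xv]
  have hnn : ∀ ω, (0 : ℝ) ≤ (∑ a ∈ T, (D ω).X a.1 a.2 * ev (A a) (D ω)) ^ q := fun ω => by
    rw [hq, pow_mul]; positivity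
  have h1 : ∫⁻ ω, ‖∑ a ∈ T, (D ω).X a.1 a.2 * ev (A a) (D ω)‖ₑ ^ q ∂μ
      = ENNReal.ofReal (∫ ω, (∑ a ∈ T, (D ω).X a.1 a.2 * ev (A a) (D ω)) ^ q ∂μ) := by
    rw [ofReal_integral_eq_lintegral_ofReal _ (Filter.Eventually.of_forall hnn)]
    · refine lintegral_congr fun ω => ?_
      rw [← enorm_pow, Real.enorm_of_nonneg (hnn ω)]
    · simp only [hexp]
      exact integrable_finsetSum _ fun f _ => hint f
  rw [h1]
  refine (Real.ofReal_le_enorm _).trans ?_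
  simp only [hexp]
  rw [integral_finsetSum _ fun f _ => hint f]
  refine (enorm_sum_le _ _).trans ?_
  have h2 : ∀ f : Fin q → T,
      ‖∫ ω, ∏ l, ((D ω).X (f l).1.1 (f l).1.2 * ev (A (f l)) (D ω)) ∂μ‖ₑ
      ≤ (mixedConst K Γ q * ε ^ q * ((N : ℝ≥0)⁻¹) ^ (Finset.univ.image f).card : ℝ≥0) := by
    intro f
    refine (enorm_integral_mixed_le (f := fun l => (f l).1) (A := fun l => A (f l).1)
      (S := {b | ∃ a ∈ T, b = xv a}) (fun l => ⟨_, (f l).2, rfl⟩) (fun l => hs _ (f l).2) (fun l => hb _ (f l).2) hD).trans ?_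
    rw [ENNReal.coe_le_coe, mul_assoc]
    have hcard : (Finset.univ.image fun l => (f l).1).card = (Finset.univ.image f).card := by
      rw [← Finset.card_image_of_injective (Finset.univ.image f) Subtype.val_injective,
        Finset.image_image]
      rfl
    -- The exponent of `rN` is at least twice the number of distinct entries, so each distinct entry
    -- contributes a factor `1/N`.
    have := two_mul_card_image_le fun l => (f l).1
    rw [hcard] at this
    rw [← rN_sq, ← pow_mul]
    refine mul_le_mul_right (mul_le_mul_right ?_ _) _
    exact pow_le_pow_of_le_one zero_le (rN_le_one hN) this
  refine (Finset.sum_le_sum fun f _ => h2 f).trans ?_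
  rw [← ENNReal.ofNNReal_finsetSum, ← ENNReal.coe_pow, ENNReal.coe_le_coe, ← Finset.mul_sum]
  refine (mul_le_mul_right (sum_inv_pow_card_image_le hN (by simpa using hT) q) _).trans ?_
  rw [mul_pow, sumConst, ← hq]
  set B := mixedConst K Γ q * ∏ l ∈ Finset.range q, ((l : ℝ≥0) + c) with hB
  calc _ = B * ε ^ q := by rw [hB]; ring
    -- Adding 1 makes the base at least 1, so that it can replace the `q`-th root of `B`.
    _ ≤ (1 + B) ^ q * ε ^ q := by
      gcongr
      exact (le_add_of_nonneg_left zero_le).trans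
        (le_self_pow₀ (le_add_of_nonneg_right zero_le) hq0)

end Core

-- All-reaching vertices and their weights

section Graph

variable {N d : ℕ}

/-- The vertices of the graph that belong to a variable. -/
def ends : DVar N d → Finset (Fin d ⊕ Fin N)
  | .X i j => {.inl j, .inr i}
  | .bstar i => {.inr i}
  | .b _ i => {.inr i}
  | .h _ j => {.inl j}

theorem mem_verts {P : Multiset (DVar N d)} {k : Fin d ⊕ Fin N} :
    k ∈ (graph P).verts ↔ ∃ a ∈ P, k ∈ ends a := by
  rcases k with j | i
  · constructor
    · rintro (⟨s, h⟩ | ⟨i, h⟩)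
      · exact ⟨_, h, by simp [ends]⟩
      · exact ⟨_, h, by simp [ends]⟩
    · rintro ⟨a, ha, hk⟩
      rcases a with ⟨i', j'⟩ | i' | ⟨s, i'⟩ | ⟨s, j'⟩ <;> simp [ends] at hk
      · subst hk; exact Or.inr ⟨_, ha⟩
      · subst hk; exact Or.inl ⟨_, ha⟩
  · constructor
    · rintro (h | ⟨s, h⟩ | ⟨i, h⟩)
      · exact ⟨_, h, by simp [ends]⟩
      · exact ⟨_, h, by simp [ends]⟩
      · exact ⟨_, h, by simp [ends]⟩
    · rintro ⟨a, ha, hk⟩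
      rcases a with ⟨i', j'⟩ | i' | ⟨s, i'⟩ | ⟨s, j'⟩ <;> simp [ends] at hk
      · subst hk; exact Or.inr (Or.inr ⟨_, ha⟩)
      · subst hk; exact Or.inl ha
      · subst hk; exact Or.inr (Or.inl ⟨_, ha⟩)

/-- The set `S` is a union of components of the graph of `P` and of vertices outside. -/
def ClosedUnder (P : Multiset (DVar N d)) (S : Set (Fin d ⊕ Fin N)) : Prop :=
  ∀ i j, DVar.X i j ∈ P → (Sum.inl j ∈ S ↔ Sum.inr i ∈ S)

theorem ClosedUnder.of_adj {P : Multiset (DVar N d)} {S : Set (Fin d ⊕ Fin N)}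
    (hS : ClosedUnder P S) {k l : Fin d ⊕ Fin N} (h : (graph P).Adj k l) (hk : k ∈ S) : l ∈ S := by
  rcases k with j | i <;> rcases l with j' | i'
  · exact h.elim
  · exact (hS i' j h).1 hk
  · exact (hS i j' h).2 hk
  · exact h.elim

/-- Connectedness in terms of cuts. -/
theorem allReaching_iff {P : Multiset (DVar N d)} {k : Fin d ⊕ Fin N} :
    AllReaching P k ↔ P = 0 ∨ ((∃ a ∈ P, k ∈ ends a) ∧
      ∀ S : Set (Fin d ⊕ Fin N), k ∈ S → ClosedUnder P S → ∀ a ∈ P, ∀ x ∈ ends a, x ∈ S) := by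
  rw [AllReaching, Multiset.card_eq_zero]
  refine or_congr_right ?_
  rw [mem_verts]
  refine and_congr_right fun hk => ?_
  constructor
  · intro hc S hkS hS a ha x hx
    have key : ∀ u v : (graph P).verts, (graph P).coe.Reachable u v → u.1 ∈ S → v.1 ∈ S := by
      rintro u v ⟨w⟩
      induction w with
      | nil => exact id
      | cons hadj _ ih => exact fun hu => ih (hS.of_adj hadj hu)
    exact key ⟨k, mem_verts.2 hk⟩ ⟨x, mem_verts.2 ⟨a, ha, hx⟩⟩ (hc.preconnected _ _) hkS
  · intro h
    have hkv := mem_verts.2 hk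
    have key : ∀ x (hx : x ∈ (graph P).verts), (graph P).coe.Reachable ⟨k, hkv⟩ ⟨x, hx⟩ := by
      intro x hx
      obtain ⟨a, ha, hxa⟩ := mem_verts.1 hx
      -- The cut to test is the component of `k`; closedness then says that everything in `P` is
      -- reachable from `k`.
      obtain ⟨_, hr⟩ := h {x | ∃ hx : x ∈ (graph P).verts, (graph P).coe.Reachable ⟨k, hkv⟩ ⟨x, hx⟩}
        ⟨hkv, SimpleGraph.Reachable.refl _⟩ (by
          intro i j hX
          have hi : (Sum.inr i : Fin d ⊕ Fin N) ∈ (graph P).verts :=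
            mem_verts.2 ⟨_, hX, by simp [ends]⟩
          have hj : (Sum.inl j : Fin d ⊕ Fin N) ∈ (graph P).verts :=
            mem_verts.2 ⟨_, hX, by simp [ends]⟩
          have hadj : (graph P).coe.Adj ⟨Sum.inl j, hj⟩ ⟨Sum.inr i, hi⟩ := hX
          exact ⟨fun ⟨_, hr⟩ => ⟨hi, hr.trans hadj.reachable⟩,
            fun ⟨_, hr⟩ => ⟨hj, hr.trans hadj.symm.reachable⟩⟩) a ha x hxa
      exact hr
    have : Nonempty (graph P).verts := ⟨⟨k, hkv⟩⟩
    exact ⟨⟨fun u v => (key u.1 u.2).symm.trans (key v.1 v.2)⟩⟩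

/-- Two connected graphs sharing the vertex `k` have a connected union. With cuts: a set closed for
the union is closed for each part. -/
theorem AllReaching.add {P Q : Multiset (DVar N d)} {k : Fin d ⊕ Fin N} (hP : AllReaching P k)
    (hQ : AllReaching Q k) : AllReaching (P + Q) k := by
  rcases allReaching_iff.1 hP with rfl | ⟨⟨a, ha, hka⟩, hP'⟩
  · rwa [zero_add]
  rcases allReaching_iff.1 hQ with rfl | ⟨-, hQ'⟩
  · rwa [add_zero]
  refine allReaching_iff.2 (Or.inr ⟨⟨a, by simp [ha], hka⟩, fun S hkS hS b hb x hx => ?_⟩)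
  rcases Multiset.mem_add.1 hb with hb | hb
  · exact hP' S hkS (fun i j h => hS i j (by simp [h])) b hb x hx
  · exact hQ' S hkS (fun i j h => hS i j (by simp [h])) b hb x hx

theorem AllReaching.change {P : Multiset (DVar N d)} {k l : Fin d ⊕ Fin N} (hP : AllReaching P k)
    (hl : ∃ a ∈ P, l ∈ ends a) : AllReaching P l := by
  rcases hP with h | ⟨-, h⟩
  · exact Or.inl h
  · exact Or.inr ⟨mem_verts.2 hl, h⟩

theorem allReaching_zero (k : Fin d ⊕ Fin N) : AllReaching (0 : Multiset (DVar N d)) k :=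
  Or.inl rfl

theorem allReaching_singleton {a : DVar N d} {k : Fin d ⊕ Fin N} (hk : k ∈ ends a) :
    AllReaching ({a} : Multiset (DVar N d)) k := by
  refine allReaching_iff.2 (Or.inr ⟨⟨a, by simp, hk⟩, fun S hkS hS b hb x hx => ?_⟩)
  obtain rfl := Multiset.mem_singleton.1 hb
  rcases b with ⟨i, j⟩ | i | ⟨s, i⟩ | ⟨s, j⟩
  · have := hS i j (by simp)
    simp only [ends, Finset.mem_insert, Finset.mem_singleton] at hk hx
    rcases hk with rfl | rfl <;> rcases hx with rfl | rfl <;> tauto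
  all_goals
    simp only [ends, Finset.mem_singleton] at hk hx
    subst hk
    subst hx
    exact hkS

theorem AllReaching.cons {R : Multiset (DVar N d)} {a : DVar N d} {k l : Fin d ⊕ Fin N}
    (hk : k ∈ ends a) (hl : l ∈ ends a) (hR : AllReaching R l) : AllReaching ({a} + R) k :=
  ((allReaching_singleton hl).add hR).change ⟨a, by simp, hk⟩

/-- Attaching edges from `ν` to vertices outside the graph of `P` makes no such vertex
all-reaching, unless `ν` is. -/
theorem allReaching_of_star {P Q : Multiset (DVar N d)} {ν l : Fin d ⊕ Fin N} (hP0 : P ≠ 0)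
    (hQ : ∀ a ∈ Q, ∃ x, x ∉ (graph P).verts ∧ x ≠ ν ∧ ends a = {x, ν})
    (hl : l ∉ (graph P).verts) (h : AllReaching (Q + P) l) : AllReaching P ν := by
  rcases allReaching_iff.1 h with h0 | ⟨-, h⟩
  · exact absurd (add_eq_zero.1 h0).2 hP0
  have hQX : ∀ i j, DVar.X i j ∈ Q → (Sum.inl j ∉ (graph P).verts ∧ Sum.inr i = ν) ∨
      (Sum.inr i ∉ (graph P).verts ∧ Sum.inl j = ν) := by
    intro i j hX
    obtain ⟨x, hx, hxν, he⟩ := hQ _ hX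
    have h1 : (Sum.inl j : Fin d ⊕ Fin N) ∈ ({x, ν} : Finset _) := by rw [← he]; simp [ends]
    have h2 : (Sum.inr i : Fin d ⊕ Fin N) ∈ ({x, ν} : Finset _) := by rw [← he]; simp [ends]
    simp only [Finset.mem_insert, Finset.mem_singleton] at h1 h2
    rcases h1 with rfl | rfl <;> rcases h2 with h2 | h2
    · simp at h2
    · exact Or.inl ⟨hx, h2⟩
    · exact Or.inr ⟨h2 ▸ hx, rfl⟩
    · simp at h2
  have hPX : ∀ i j, DVar.X i j ∈ P → Sum.inl j ∈ (graph P).verts ∧ Sum.inr i ∈ (graph P).verts :=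
    fun i j hX => ⟨mem_verts.2 ⟨_, hX, by simp [ends]⟩, mem_verts.2 ⟨_, hX, by simp [ends]⟩⟩
  have key : ∀ S : Set (Fin d ⊕ Fin N), ν ∈ S ∪ (graph P).vertsᶜ → ClosedUnder P S →
      ∀ a ∈ P, ∀ x ∈ ends a, x ∈ S := by
    intro S hνS hS a ha x hx
    -- Adding all vertices outside `P` to a cut `S` of `P` containing `ν` makes it closed under the
    -- star as well, and puts `l` into it; on the vertices of `P` it is still `S`.
    have hx' := h (S ∪ (graph P).vertsᶜ) (Or.inr hl) (by
      intro i j hX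
      rcases Multiset.mem_add.1 hX with hX | hX
      · rcases hQX i j hX with ⟨h1, h2⟩ | ⟨h1, h2⟩
        · rw [h2]; exact ⟨fun _ => hνS, fun _ => Or.inr h1⟩
        · rw [h2]; exact ⟨fun _ => Or.inr h1, fun _ => hνS⟩
      · have h1 := hPX i j hX
        have h2 := hS i j hX
        simp only [Set.mem_union, Set.mem_compl_iff, h1.1, h1.2, not_true, or_false]
        exact h2) a (by simp [ha]) x hx
    exact hx'.resolve_right fun h => h (mem_verts.2 ⟨a, ha, hx⟩)
  by_cases hν : ν ∈ (graph P).verts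
  · exact allReaching_iff.2 (Or.inr ⟨mem_verts.1 hν, fun S hνS hS => key S (Or.inl hνS) hS⟩)
  · exfalso
    obtain ⟨a, ha⟩ := Multiset.exists_mem_of_ne_zero hP0
    have hne : (ends a).Nonempty := by
      rcases a with ⟨i, j⟩ | i | ⟨s, i⟩ | ⟨s, j⟩ <;> simp [ends]
    obtain ⟨x, hx⟩ := hne
    exact key ∅ (Or.inr hν) (fun i j _ => by simp) a ha x hx

/-- The order of magnitude of `∂_P` of a variable attached to the vertex `k`. -/
def wt (k : Fin d ⊕ Fin N) (P : List (DVar N d)) : ℝ≥0 :=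
  open Classical in if AllReaching (P : Multiset (DVar N d)) k then 1 else rN N

theorem rN_le_wt (hN : 0 < N) (k : Fin d ⊕ Fin N) (P : List (DVar N d)) : rN N ≤ wt k P := by
  unfold wt
  split_ifs
  · exact rN_le_one hN
  · exact le_rfl

theorem wt_le_one (hN : 0 < N) (k : Fin d ⊕ Fin N) (P : List (DVar N d)) : wt k P ≤ 1 := by
  unfold wt
  split_ifs
  · exact le_rfl
  · exact rN_le_one hN

theorem wt_of_allReaching {k : Fin d ⊕ Fin N} {P : List (DVar N d)}
    (h : AllReaching (P : Multiset (DVar N d)) k) : wt k P = 1 := if_pos h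

theorem wt_le_wt (hN : 0 < N) {k l : Fin d ⊕ Fin N} {P Q : List (DVar N d)}
    (h : AllReaching (P : Multiset (DVar N d)) k → AllReaching (Q : Multiset (DVar N d)) l) :
    wt k P ≤ wt l Q := by
  by_cases hP : AllReaching (P : Multiset (DVar N d)) k
  · rw [wt_of_allReaching (h hP)]
    exact wt_le_one hN k P
  · rw [wt, if_neg hP]
    exact rN_le_wt hN l Q

/-- Submultiplicativity is what makes the weights compatible with the Leibniz and chain rules: if
both factors have weight 1, then so has the union; otherwise one factor provides `rN`. -/
theorem wt_mul_wt_le (hN : 0 < N) {k : Fin d ⊕ Fin N} {P Q R : List (DVar N d)}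
    (h : (P : Multiset (DVar N d)) = (Q : Multiset (DVar N d)) + (R : Multiset (DVar N d))) :
    wt k Q * wt k R ≤ wt k P := by
  by_cases hQ : AllReaching (Q : Multiset (DVar N d)) k
  · refine (mul_le_of_le_one_left zero_le (wt_le_one hN k Q)).trans (wt_le_wt hN fun hR => ?_)
    rw [h]
    exact hQ.add hR
  · have : wt k Q = rN N := if_neg hQ
    rw [this]
    exact (mul_le_of_le_one_right zero_le (wt_le_one hN k R)).trans (rN_le_wt hN k P)

theorem card_ends_le (a : DVar N d) : (ends a).card ≤ 2 := by
  rcases a with ⟨i, j⟩ | i | ⟨s, i⟩ | ⟨s, j⟩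
  · exact Finset.card_le_two
  all_goals simp [ends]

/-- At most `2 |P|` vertices belong to the graph of `P`. -/
theorem card_filter_mem_verts_le {ι : Type*} [Fintype ι] {opp : ι → Fin d ⊕ Fin N}
    (hopp : Function.Injective opp) (P : List (DVar N d))
    [DecidablePred fun l => opp l ∈ (graph (P : Multiset (DVar N d))).verts] :
    (Finset.univ.filter fun l => opp l ∈ (graph (P : Multiset (DVar N d))).verts).card
      ≤ 2 * P.length := by
  classical
  rw [← Finset.card_image_of_injective _ hopp]
  calc _ ≤ (P.toFinset.biUnion ends).card := by
        refine Finset.card_le_card fun x hx => ?_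
        obtain ⟨l, hl, rfl⟩ := Finset.mem_image.1 hx
        obtain ⟨a, ha, hx⟩ := mem_verts.1 (Finset.mem_filter.1 hl).2
        exact Finset.mem_biUnion.2 ⟨a, by simpa using ha, hx⟩
    _ ≤ P.toFinset.card * 2 := Finset.card_biUnion_le_card_mul _ _ _ fun a _ => card_ends_le a
    _ ≤ 2 * P.length := by rw [mul_comm]; exact Nat.mul_le_mul_left _ (List.toFinset_card_le P)

end Graph

/-- The functional `Y` is smooth, and in all models its derivatives have the order of magnitude of
a variable attached to the vertex `k`, with constants `Γ`. -/
def Good (K : ℕ → ℝ≥0) (Γ : ℕ → ℕ → ℝ≥0) {N d : ℕ} (k : Fin d ⊕ Fin N) (Y : Fnl N d) : Prop :=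
  Smooth Y ∧ ∀ (Ω : Type u) [MeasurableSpace Ω] (μ : Measure Ω) [IsProbabilityMeasure μ],
    Bd K μ Γ (wt k) Set.univ Y

-- Propagation of the bounds through `X` and its transpose

section Linear

variable {N d : ℕ} {K : ℕ → ℝ≥0}

theorem Good.mono {Γ Γ' : ℕ → ℕ → ℝ≥0} {k : Fin d ⊕ Fin N} {Y : Fnl N d}
    (hY : Good.{u} K Γ k Y) (h : ∀ m p, Γ m p ≤ Γ' m p) : Good.{u} K Γ' k Y :=
  ⟨hY.1, fun Ω _ μ _ D hD P hP p => (hY.2 Ω μ D hD P hP p).trans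
    (ENNReal.coe_le_coe.2 (mul_le_mul_left (h _ _) _))⟩

theorem Good.add {Γ Γ' : ℕ → ℕ → ℝ≥0} {k : Fin d ⊕ Fin N} {Y Z : Fnl N d}
    (hY : Good.{u} K Γ k Y) (hZ : Good.{u} K Γ' k Z) :
    Good.{u} K (fun m p => Γ m p + Γ' m p) k (Y + Z) := by
  refine ⟨hY.1.add hZ.1, fun Ω _ μ _ D hD P hP p => ?_⟩
  rw [pdl_add hY.1 hZ.1]
  refine (eLpNorm_natCast_add_le (hD.aesm (hY.1.pdl P)) (hD.aesm (hZ.1.pdl P)) p).trans ?_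
  rw [add_mul, ENNReal.coe_add]
  exact add_le_add (hY.2 Ω μ D hD P hP p) (hZ.2 Ω μ D hD P hP p)

/-- A functional of the data only, with controlled moments. -/
theorem Good.const {φ : Data N d → ℝ} (hφ : Measurable φ) (hinv : ∀ D x, φ (D.withX x) = φ D)
    (hb : ∀ (Ω : Type u) [MeasurableSpace Ω] (μ : Measure Ω) (D : Ω → Data N d), Model K μ D →
      ∀ p : ℕ, eLpNorm (fun ω => φ (D ω)) p μ ≤ K p) (k : Fin d ⊕ Fin N) :
    Good.{u} K (fun _ p => K p) k (fun D _ => φ D) := by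
  refine ⟨Smooth.const hφ hinv, fun Ω _ μ _ D hD P _ p => ?_⟩
  rcases eq_or_ne P [] with rfl | hP
  · rw [wt_of_allReaching (allReaching_zero k), mul_one]
    exact hb Ω μ D hD p
  · rw [pdl_const φ hP]
    simp [ev]

/-- An external field attached to the vertex `k`. -/
theorem Good.coord {a : DVar N d} {k : Fin d ⊕ Fin N} (hk : k ∈ ends a)
    (ha : ∀ x, basePoint x a = 0) : Good.{u} K (fun _ _ => 1) k (coord a) := by
  refine ⟨Smooth.coord a, fun Ω _ μ _ D hD P _ p => ?_⟩
  rw [pdl_coord]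
  split_ifs with h₁ h₂
  · simp [ev, GFOM.coord, ha]
  · subst h₂
    rw [wt_of_allReaching (allReaching_singleton hk)]
    refine (eLpNorm_le_of_ae_bound (C := 1) (Filter.Eventually.of_forall fun ω => ?_)).trans ?_
    · simp [ev]
    · simp
  · simp [ev]

theorem pdl_coord_mul {a : DVar N d} {Y : Fnl N d} (hY : Smooth Y) {P : List (DVar N d)}
    (ha : a ∉ P) : pdl P (coord a * Y) = coord a * pdl P Y := by
  induction P with
  | nil => rfl
  | cons b P ih =>
    simp only [List.mem_cons, not_or] at ha
    rw [pdl_cons, ih ha.2, pd_mul (Smooth.coord a) (hY.pdl P), (HasPD.coord a b).pd_eq, pdl_cons]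
    simp only [ha.1, if_false]
    change 0 * _ + _ = _
    rw [zero_mul, zero_add]

/-- The constants for `X v` and `Xᵀ u`. -/
def linConst (K : ℕ → ℝ≥0) (c : ℕ) (Γ : ℕ → ℕ → ℝ≥0) (m p : ℕ) : ℝ≥0 :=
  sumConst K c (fun m' p' => Γ (m' + m) p') p + 2 * m * mulConst (fun _ p => K p + 1) Γ m p

/-- This bounds a single term, without cancellation. Used only for the boundedly many indices whose
opposite vertex lies in the graph of `P`. -/
theorem eLpNorm_pdl_coord_mul_le {Ω : Type u} [MeasurableSpace Ω] {μ : Measure Ω}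
    [IsProbabilityMeasure μ] (hN : 0 < N) {Γ : ℕ → ℕ → ℝ≥0} {a : Fin N × Fin d}
    {k ν : Fin d ⊕ Fin N} (hk : k ∈ ends (xv a)) (hν : ν ∈ ends (xv a)) {Y : Fnl N d}
    (hY : Good.{u} K Γ k Y) {D : Ω → Data N d} (hD : Model K μ D) (P : List (DVar N d)) (p : ℕ) :
    eLpNorm (fun ω => ev (pdl P (GFOM.coord (xv a) * Y)) (D ω)) p μ
      ≤ (mulConst (fun _ p => K p + 1) Γ P.length p * wt ν P : ℝ≥0) := by
  -- An undifferentiated entry already gives `rN`. If the entry absorbs exactly the derivative `xv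
  -- a`, the other derivatives fall on `Y`, and the edge from `k` to `ν` transfers all-reachingness
  -- to `ν` in `P`.
  refine eLpNorm_pdl_mul_le_mulConst
    (W := fun Q => if Q = [] then rN N else if Q = [xv a] then 1 else 0) (W' := wt k) hD
    (Smooth.coord _) hY.1 (fun q _ => ?_) (fun q _ => hY.2 Ω μ D hD q.2 (by simp) _) fun q hq => ?_
  · rw [pdl_coord]
    split_ifs with h₁ h₂
    · refine (hD.norm_X a _).trans (ENNReal.coe_le_coe.2 ?_)
      gcongr
      exact le_add_of_nonneg_right zero_le
    · refine (eLpNorm_le_of_ae_bound (C := 1) (Filter.Eventually.of_forall fun ω => ?_)).trans ?_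
      · simp [ev]
      · simp
    · simp [ev]
  · have hco := coe_of_mem_splits hq
    split_ifs with h₁ h₂
    · exact (mul_le_of_le_one_right zero_le (wt_le_one hN k _)).trans (rN_le_wt hN ν P)
    · rw [one_mul]
      refine wt_le_wt hN fun h => ?_
      rw [hco, h₂]
      exact h.cons hν hk
    · simp

/-- The fields `X v` and `Xᵀ u` inherit good bounds from `v` and `u`. -/
theorem Good.linear {c : ℕ} {Γ : ℕ → ℕ → ℝ≥0} (hN : 0 < N) {ι : Type*} [Fintype ι]
    (hι : Fintype.card ι ≤ c * N) {ν : Fin d ⊕ Fin N} {opp : ι → Fin d ⊕ Fin N}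
    (hopp : Function.Injective opp) {e : ι → Fin N × Fin d} (hinj : Function.Injective e)
    (he : ∀ l, ends (xv (e l)) = {opp l, ν}) (hne : ∀ l, opp l ≠ ν) {Y : ι → Fnl N d}
    (hY : ∀ l, Good.{u} K Γ (opp l) (Y l)) :
    Good.{u} K (linConst K c Γ) ν (∑ l, GFOM.coord (xv (e l)) * Y l) := by
  classical
  have hs : ∀ l, Smooth (GFOM.coord (xv (e l)) * Y l) := fun l => (Smooth.coord _).mul (hY l).1
  refine ⟨Smooth.sum _ fun l _ => hs l, fun Ω _ μ _ D hD P _ p => ?_⟩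
  set V := (graph (P : Multiset (DVar N d))).verts with hV
  -- These are the indices whose opposite vertex is outside the graph of `P`. For them `P` does not
  -- contain the edge, so `∂_P` falls entirely on `Y l`.
  set T₀ : Finset ι := Finset.univ.filter fun l => ¬ opp l ∈ V with hT₀
  -- The sum lemma is indexed by matrix entries, so the weights are transported along `e`; the
  -- values off its range are irrelevant.
  set A : Fin N × Fin d → Fnl N d := Function.extend e (fun l => pdl P (Y l)) 0 with hA
  have hAe : ∀ l, A (e l) = pdl P (Y l) := fun l => hinj.extend_apply _ _ _
  set T := T₀.image e with hT
  have hnotP : ∀ l ∈ T₀, xv (e l) ∉ P := fun l hl hP =>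
    (Finset.mem_filter.1 hl).2 (mem_verts.2 ⟨_, hP, by simp [he]⟩)
  have hsplit : ∀ ω, ev (pdl P (∑ l, GFOM.coord (xv (e l)) * Y l)) (D ω)
      = ∑ a ∈ T, (D ω).X a.1 a.2 * ev (A a) (D ω)
        + ∑ l ∈ Finset.univ.filter (fun l => opp l ∈ V),
            ev (pdl P (GFOM.coord (xv (e l)) * Y l)) (D ω) := by
    intro ω
    rw [pdl_sum _ fun l _ => hs l, hT, Finset.sum_image hinj.injOn, add_comm]
    have h1 : ev (∑ l, pdl P (GFOM.coord (xv (e l)) * Y l)) (D ω)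
        = ∑ l, ev (pdl P (GFOM.coord (xv (e l)) * Y l)) (D ω) := by
      simp [ev, Finset.sum_apply]
    rw [h1, ← Finset.sum_filter_add_sum_filter_not Finset.univ fun l => opp l ∈ V]
    congr 1
    refine Finset.sum_congr rfl fun l hl => ?_
    rw [hAe, pdl_coord_mul (hY l).1 (hnotP l hl)]
    rfl
  simp only [hsplit]
  have hAs : ∀ a ∈ T, Smooth (A a) := fun a ha => by
    obtain ⟨l, -, rfl⟩ := Finset.mem_image.1 ha
    rw [hAe]
    exact (hY l).1.pdl P
  have hm1 : AEStronglyMeasurable (fun ω => ∑ a ∈ T, (D ω).X a.1 a.2 * ev (A a) (D ω)) μ :=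
    Finset.aestronglyMeasurable_fun_sum _ fun a ha =>
      ((measurable_X_apply a).comp hD.meas).aestronglyMeasurable.mul (hD.aesm (hAs a ha))
  have hm2 : ∀ l, AEStronglyMeasurable
      (fun ω => ev (pdl P (GFOM.coord (xv (e l)) * Y l)) (D ω)) μ :=
    fun l => hD.aesm ((hs l).pdl P)
  refine (eLpNorm_natCast_add_le hm1 (Finset.aestronglyMeasurable_fun_sum _ fun l _ => hm2 l)
    p).trans ?_
  rw [linConst, add_mul, ENNReal.coe_add]
  refine add_le_add ?_ ?_
  · refine eLpNorm_sum_entries_le hN ?_ hAs ?_ hD p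
    · refine Finset.card_image_le.trans ((Finset.card_filter_le _ _).trans ?_)
      simpa using hι
    · intro a ha
      obtain ⟨l, hl, rfl⟩ := Finset.mem_image.1 ha
      rw [hAe]
      intro D' hD' Q hQ p'
      rw [← pdl_append]
      refine ((hY l).2 Ω μ D' hD' (Q ++ P) (by simp) p').trans ?_
      rw [List.length_append, ENNReal.coe_le_coe]
      -- Here `Q` consists of edges from `ν` to vertices outside the graph of `P`, so the star lemma
      -- bounds the weight of `Q ++ P` at `opp l` by that of `P` at `ν`, uniformly in `Q`. This is
      -- the `ε` of the sum lemma.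
      refine mul_le_mul_right (wt_le_wt hN fun h => ?_) _
      rcases eq_or_ne P [] with rfl | hP0
      · exact allReaching_zero ν
      · refine allReaching_of_star (Q := (Q : Multiset (DVar N d))) (by simpa using hP0)
          (fun b hb => ?_) (Finset.mem_filter.1 hl).2 (by simpa using h)
        obtain ⟨a, ha', rfl⟩ := hQ b (by simpa using hb)
        obtain ⟨l', hl', rfl⟩ := Finset.mem_image.1 ha'
        exact ⟨opp l', (Finset.mem_filter.1 hl').2, hne l', he l'⟩
  · refine (eLpNorm_natCast_sum_le _ (fun l _ => hm2 l) p).trans ?_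
    refine (Finset.sum_le_sum fun l _ => eLpNorm_pdl_coord_mul_le hN (k := opp l) (ν := ν)
      (by simp [he]) (by simp [he]) (hY l) hD P p).trans ?_
    rw [Finset.sum_const, nsmul_eq_mul, ← ENNReal.coe_natCast, ← ENNReal.coe_mul,
      ENNReal.coe_le_coe, mul_assoc]
    have := card_filter_mem_verts_le hopp P
    gcongr
    exact_mod_cast this

end Linear

-- Propagation of the bounds through nonlinearities

section Composition

variable {N d : ℕ} {E : Type*} [NormedAddCommGroup E] [NormedSpace ℝ E] {κ : Type*} [Fintype κ]

/-- The composition of a function with a linear combination of functionals. -/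
def compFnl (f : E → ℝ) (e : κ → E) (y : κ → Fnl N d) : Fnl N d :=
  fun D z => f (∑ k, y k D z • e k)

/-- Along one coordinate line the argument of `f` is a differentiable curve in `E`, so the
one-variable chain rule suffices; no differentiability in the infinite family of all coordinates is
required. -/
theorem HasPD.compFnl {f : E → ℝ} (hf : Differentiable ℝ f) (e : κ → E) {y y' : κ → Fnl N d}
    {a : DVar N d} (hy : ∀ k, HasPD a (y k) (y' k)) :
    HasPD a (compFnl f e y) (∑ k, compFnl (fun x => fderiv ℝ f x (e k)) e y * y' k) := fun D z => by
  have h1 : HasDerivAt (fun t : ℝ => ∑ k, y k D (z + t • Pi.single a 1) • e k)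
      (∑ k, y' k D z • e k) 0 :=
    HasDerivAt.fun_sum fun k _ => HasDerivAt.smul_const (hy k D z) (e k)
  have h2 := (hf (∑ k, y k D (z + (0 : ℝ) • Pi.single a 1) • e k)).hasFDerivAt.comp_hasDerivAt _ h1
  have h3 : (fderiv ℝ f (∑ k, y k D (z + (0 : ℝ) • Pi.single a 1) • e k)) (∑ k, y' k D z • e k)
      = (∑ k, GFOM.compFnl (fun x => fderiv ℝ f x (e k)) e y * y' k) D z := by
    simp [map_sum, GFOM.compFnl, Finset.sum_apply, mul_comm]
  rw [h3] at h2
  exact h2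

theorem contDiff_fderiv_apply {f : E → ℝ} (hf : ContDiff ℝ ((⊤ : ℕ∞) : WithTop ℕ∞) f) (v : E) :
    ContDiff ℝ ((⊤ : ℕ∞) : WithTop ℕ∞) fun x => fderiv ℝ f x v :=
  (hf.fderiv_right (m := ((⊤ : ℕ∞) : WithTop ℕ∞)) (by simp)).clm_apply contDiff_const

theorem pd_compFnl {f : E → ℝ} (hf : ContDiff ℝ ((⊤ : ℕ∞) : WithTop ℕ∞) f) (e : κ → E)
    {y : κ → Fnl N d} (hy : ∀ k, Smooth (y k)) (a : DVar N d) :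
    pd a (compFnl f e y) = ∑ k, compFnl (fun x => fderiv ℝ f x (e k)) e y * pd a (y k) :=
  (HasPD.compFnl (hf.differentiable (by simp)) e fun k => (hy k).hasPD a).pd_eq

/-- Smooth functions all of whose derivatives, of order zero included, are bounded. -/
def IsSmoothBounded (f : E → ℝ) : Prop :=
  ContDiff ℝ ((⊤ : ℕ∞) : WithTop ℕ∞) f ∧ ∀ n : ℕ, ∃ C : ℝ, ∀ x, ‖iteratedFDeriv ℝ n f x‖ ≤ C

/-- Differentiating once lands in the class of functions bounded together with all derivatives,
which is again stable under differentiation. Only order zero of `f` itself needs linear growth. -/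
theorem _root_.IsSmooth1b.fderiv_apply {f : E → ℝ} (hf : IsSmooth1b f) (v : E) :
    IsSmoothBounded fun x => fderiv ℝ f x v := by
  refine ⟨contDiff_fderiv_apply hf.1 v, fun n => ?_⟩
  obtain ⟨C, hC⟩ := hf.2 (n + 1) (by omega)
  refine ⟨‖v‖ * C, fun x => ?_⟩
  have h := norm_iteratedFDeriv_clm_apply_const (c := v) (n := n)
    ((hf.1.fderiv_right (m := ((⊤ : ℕ∞) : WithTop ℕ∞)) (by simp)).contDiffAt (x := x))
    (by exact_mod_cast le_top)
  rw [norm_iteratedFDeriv_fderiv] at h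
  exact h.trans (mul_le_mul_of_nonneg_left (hC x) (norm_nonneg v))

theorem IsSmoothBounded.isSmooth1b {f : E → ℝ} (hf : IsSmoothBounded f) : IsSmooth1b f :=
  ⟨hf.1, fun n _ => hf.2 n⟩

theorem _root_.IsSmooth1b.norm_le {f : E → ℝ} (hf : IsSmooth1b f) :
    ∃ C : ℝ≥0, ∀ x, ‖f x‖ ≤ C + C * ‖x‖ := by
  obtain ⟨C, hC⟩ := hf.2 1 le_rfl
  have hC' : ∀ x, ‖fderiv ℝ f x‖ ≤ C := fun x => by
    rw [← norm_iteratedFDeriv_one]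
    exact hC x
  have hC0 : 0 ≤ C := (norm_nonneg _).trans (hC 0)
  refine ⟨‖f 0‖₊ + C.toNNReal, fun x => ?_⟩
  have h := Convex.norm_image_sub_le_of_norm_fderiv_le (s := Set.univ) (x := 0) (y := x)
    (fun z _ => (hf.1.differentiable (by simp)) z) (fun z _ => hC' z) convex_univ
    (Set.mem_univ _) (Set.mem_univ _)
  rw [sub_zero] at h
  have h2 : ‖f x‖ ≤ ‖f 0‖ + ‖f x - f 0‖ := by
    simpa using norm_add_le (f 0) (f x - f 0)
  push_cast
  rw [Real.coe_toNNReal C hC0]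
  have h3 := norm_nonneg (f 0)
  have h4 := mul_nonneg h3 (norm_nonneg x)
  rw [add_mul]
  linarith

variable [MeasurableSpace E] [BorelSpace E] [SecondCountableTopology E]

theorem IsBase.compFnl {f : E → ℝ} (hf : Continuous f) (e : κ → E) {y : κ → Fnl N d}
    (hy : ∀ k, IsBase (y k)) : IsBase (compFnl f e y) :=
  ⟨fun D x => by unfold GFOM.compFnl; simp only [(hy _).inv],
    hf.measurable.comp (Finset.measurable_fun_sum _ fun k _ => (hy k).meas.smul_const (e k))⟩

theorem SmoothN.compFnl (e : κ → E) : ∀ {n : ℕ} {f : E → ℝ} {y : κ → Fnl N d},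
    ContDiff ℝ ((⊤ : ℕ∞) : WithTop ℕ∞) f → (∀ k, SmoothN n (y k)) → SmoothN n (compFnl f e y)
  | 0, _, _, hf, hy => IsBase.compFnl hf.continuous e hy
  | n + 1, f, y, hf, hy => by
    refine ⟨IsBase.compFnl hf.continuous e fun k => (hy k).isBase, fun a => ?_⟩
    choose y' h₁ h₂ using fun k => (hy k).2 a
    refine ⟨_, HasPD.compFnl (hf.differentiable (by simp)) e h₁, SmoothN.sum _ fun k _ => ?_⟩
    exact (SmoothN.compFnl e (contDiff_fderiv_apply hf (e k)) fun l => (hy l).of_succ).mul (h₂ k)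

theorem Smooth.compFnl {f : E → ℝ} (hf : ContDiff ℝ ((⊤ : ℕ∞) : WithTop ℕ∞) f) (e : κ → E)
    {y : κ → Fnl N d} (hy : ∀ k, Smooth (y k)) : Smooth (compFnl f e y) :=
  fun n => SmoothN.compFnl e hf fun k => hy k n

/-- Moment bounds for the derivatives of order `m` of a composition. -/
def CompBound (K : ℕ → ℝ≥0) (Γ : ℕ → ℕ → ℝ≥0) (e : κ → E) (f : E → ℝ) (m : ℕ)
    (B : ℕ → ℝ≥0) : Prop :=
  ∀ {N d : ℕ}, 0 < N → ∀ (k : Fin d ⊕ Fin N) (y : κ → Fnl N d), (∀ l, Good.{u} K Γ k (y l)) →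
    ∀ (Ω : Type u) [MeasurableSpace Ω] (μ : Measure Ω) [IsProbabilityMeasure μ]
      (D : Ω → Data N d), Model K μ D → ∀ P : List (DVar N d), P.length = m → ∀ p : ℕ,
      eLpNorm (fun ω => ev (pdl P (compFnl f e y)) (D ω)) p μ ≤ (B p * wt k P : ℝ≥0)

/-- Peel off the innermost derivative `a`, so that the chain rule acts on the undifferentiated
composition. The other derivatives are distributed over the directional derivative of `f` at `y` and
`∂_a y`, and the weights multiply. -/
theorem CompBound.succ {K : ℕ → ℝ≥0} {Γ : ℕ → ℕ → ℝ≥0} {e : κ → E} {f : E → ℝ}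
    (hf : ContDiff ℝ ((⊤ : ℕ∞) : WithTop ℕ∞) f) {m : ℕ} {B : κ → ℕ → ℕ → ℝ≥0}
    (hB : ∀ l, ∀ m' ≤ m, CompBound.{u} K Γ e (fun x => fderiv ℝ f x (e l)) m' (B l m')) :
    CompBound.{u} K Γ e f (m + 1) fun p =>
      ∑ l, mulConst (B l) (fun m' => Γ (m' + 1)) m p := by
  intro N d hN k y hy Ω _ μ _ D hD P hP p
  obtain ⟨P, a, rfl⟩ := List.eq_nil_or_concat P |>.resolve_left (by rintro rfl; simp at hP)
  rw [List.concat_eq_append] at hP ⊢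
  have hlen : P.length = m := by simpa using hP
  have hys : ∀ l, Smooth (y l) := fun l => (hy l).1
  have hfs : ∀ l, Smooth (compFnl (fun x => fderiv ℝ f x (e l)) e y) := fun l =>
    Smooth.compFnl (contDiff_fderiv_apply hf (e l)) e hys
  have hms : ∀ l, Smooth (compFnl (fun x => fderiv ℝ f x (e l)) e y * pd a (y l)) := fun l =>
    (hfs l).mul ((hys l).pd a)
  rw [pdl_concat, pd_compFnl hf e hys, pdl_sum _ fun l _ => hms l]
  have hev : ∀ ω, ev (∑ l, pdl P (compFnl (fun x => fderiv ℝ f x (e l)) e y * pd a (y l))) (D ω)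
      = ∑ l, ev (pdl P (compFnl (fun x => fderiv ℝ f x (e l)) e y * pd a (y l))) (D ω) := fun ω => by
    simp [ev, Finset.sum_apply]
  simp only [hev]
  refine (eLpNorm_natCast_sum_le _ (fun l _ => hD.aesm ((hms l).pdl P)) p).trans ?_
  rw [Finset.sum_mul, ENNReal.ofNNReal_finsetSum]
  refine Finset.sum_le_sum fun l _ => ?_
  rw [← hlen]
  -- The weight of the second factor keeps track of `a`, so that the two blocks together make up all
  -- of `P ++ [a]`.
  refine eLpNorm_pdl_mul_le_mulConst (W := wt k) (W' := fun R => wt k (R ++ [a])) hD (hfs l)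
    ((hys l).pd a) (fun q hq => ?_) (fun q hq => ?_) fun q hq => ?_
  · have hq' : q.1.length ≤ m := by
      have := congrArg Multiset.card (coe_of_mem_splits hq)
      simp at this
      omega
    exact hB l q.1.length hq' hN k y hy Ω μ D hD q.1 rfl (2 * p)
  · rw [← pdl_concat]
    have := (hy l).2 Ω μ D hD (q.2 ++ [a]) (by simp) (2 * p)
    rwa [List.length_append, List.length_singleton] at this
  · refine wt_mul_wt_le hN ?_
    rw [← Multiset.coe_add, ← Multiset.coe_add, coe_of_mem_splits hq, add_assoc]

theorem IsSmoothBounded.exists_compBound (K : ℕ → ℝ≥0) (Γ : ℕ → ℕ → ℝ≥0) (e : κ → E) (m : ℕ) :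
    ∀ {f : E → ℝ}, IsSmoothBounded f → ∃ B, CompBound.{u} K Γ e f m B := by
  induction m using Nat.strong_induction_on with
  | _ m ih =>
    intro f hf
    rcases m with _ | m
    · obtain ⟨C, hC⟩ := hf.2 0
      refine ⟨fun _ => C.toNNReal, fun {N d} hN k y hy Ω _ μ _ D hD P hP p => ?_⟩
      obtain rfl := List.length_eq_zero_iff.1 hP
      rw [wt_of_allReaching (allReaching_zero k), mul_one]
      refine (eLpNorm_le_of_ae_bound (C := C) (Filter.Eventually.of_forall fun ω => ?_)).trans ?_
      · simpa [ev, compFnl] using hC (∑ l, y l (D ω) (basePoint (D ω).X) • e l)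
      · simp [ENNReal.ofReal]
    · have h : ∀ (l : κ) (m' : ℕ), ∃ B, m' ≤ m →
          CompBound.{u} K Γ e (fun x => fderiv ℝ f x (e l)) m' B := by
        intro l m'
        by_cases hm : m' ≤ m
        · obtain ⟨B, hB⟩ := ih m' (by omega) (hf.isSmooth1b.fderiv_apply (e l))
          exact ⟨B, fun _ => hB⟩
        · exact ⟨0, fun h => absurd h hm⟩
      choose B hB using h
      exact ⟨_, CompBound.succ hf.1 hB⟩

theorem _root_.IsSmooth1b.exists_compBound (K : ℕ → ℝ≥0) (Γ : ℕ → ℕ → ℝ≥0) (e : κ → E) (m : ℕ)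
    {f : E → ℝ} (hf : IsSmooth1b f) : ∃ B, CompBound.{u} K Γ e f m B := by
  rcases m with _ | m
  · obtain ⟨C, hC⟩ := hf.norm_le
    -- Order zero: `f` is unbounded, but its linear growth reduces the bound to the moments of the
    -- arguments.
    refine ⟨fun p => C + ∑ l, C * ‖e l‖₊ * Γ 0 p, fun {N d} hN k y hy Ω _ μ _ D hD P hP p => ?_⟩
    obtain rfl := List.length_eq_zero_iff.1 hP
    rw [wt_of_allReaching (allReaching_zero k), mul_one]
    have hm : ∀ l, AEStronglyMeasurable (fun ω => C * ‖e l‖ * ‖ev (y l) (D ω)‖) μ := fun l =>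
      (hD.aesm (hy l).1).norm.const_mul _
    calc eLpNorm (fun ω => ev (pdl [] (compFnl f e y)) (D ω)) p μ
        ≤ eLpNorm (fun ω => (C : ℝ) + ∑ l, C * ‖e l‖ * ‖ev (y l) (D ω)‖) p μ := by
          refine eLpNorm_mono_real fun ω => ?_
          refine (hC _).trans ?_
          rw [← Finset.sum_congr rfl fun l _ => (mul_assoc (C : ℝ) _ _).symm, ← Finset.mul_sum]
          gcongr
          refine (norm_sum_le _ _).trans (Finset.sum_le_sum fun l _ => ?_)
          rw [norm_smul, mul_comm]
          rfl
      _ ≤ eLpNorm (fun _ : Ω => (C : ℝ)) p μ +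
            eLpNorm (fun ω => ∑ l, C * ‖e l‖ * ‖ev (y l) (D ω)‖) p μ :=
          eLpNorm_natCast_add_le aestronglyMeasurable_const
            (Finset.aestronglyMeasurable_fun_sum _ fun l _ => hm l) p
      _ ≤ C + ∑ l, ((C * ‖e l‖₊ * Γ 0 p : ℝ≥0) : ℝ≥0∞) := by
          refine add_le_add ?_ ((eLpNorm_natCast_sum_le _ (fun l _ => hm l) p).trans
            (Finset.sum_le_sum fun l _ => ?_))
          · refine (eLpNorm_le_of_ae_bound (C := C)
              (Filter.Eventually.of_forall fun ω => ?_)).trans ?_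
            · simp
            · simp
          · have h := (hy l).2 Ω μ D hD [] (by simp) p
            rw [wt_of_allReaching (allReaching_zero k), mul_one] at h
            have h2 : eLpNorm (fun ω => C * ‖e l‖ * ‖ev (y l) (D ω)‖) p μ
                ≤ ‖(C : ℝ) * ‖e l‖‖ₑ * eLpNorm (fun ω => ev (y l) (D ω)) p μ := by
              rw [← eLpNorm_norm (fun ω => ev (y l) (D ω))]
              exact eLpNorm_const_smul_le (c := (C : ℝ) * ‖e l‖)
                (f := fun ω => ‖ev (y l) (D ω)‖)
            refine h2.trans ?_
            rw [ENNReal.coe_mul]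
            refine mul_le_mul' (le_of_eq ?_) h
            rw [enorm_mul, enorm_norm]
            simp [enorm_eq_nnnorm]
      _ = _ := by push_cast; rfl
  · choose B hB using fun (l : κ) (m' : ℕ) =>
      (hf.fderiv_apply (e l)).exists_compBound.{u} K Γ e m'
    exact ⟨_, CompBound.succ hf.1 fun l m' _ => hB l m'⟩

/-- The image of good functionals under a function with bounded derivatives is good. -/
theorem _root_.IsSmooth1b.exists_good (K : ℕ → ℝ≥0) (Γ : ℕ → ℕ → ℝ≥0) (e : κ → E) {f : E → ℝ}
    (hf : IsSmooth1b f) : ∃ Γ' : ℕ → ℕ → ℝ≥0, ∀ {N d : ℕ}, 0 < N → ∀ (k : Fin d ⊕ Fin N)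
      (y : κ → Fnl N d), (∀ l, Good.{u} K Γ k (y l)) → Good.{u} K Γ' k (compFnl f e y) := by
  choose B hB using fun m => hf.exists_compBound.{u} K Γ e m
  exact ⟨B, fun {N d} hN k y hy => ⟨Smooth.compFnl hf.1 e fun l => (hy l).1,
    fun Ω _ μ _ D hD P _ p => hB P.length hN k y hy Ω μ D hD P rfl p⟩⟩

end Composition

-- Induction along the orbit

section Orbit

variable {N d : ℕ} {K : ℕ → ℝ≥0}

theorem Good.row {c : ℕ} {Γ : ℕ → ℕ → ℝ≥0} (hN : 0 < N) (hd : d ≤ c * N) {Y : Fin d → Fnl N d}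
    (hY : ∀ j, Good.{u} K Γ (Sum.inl j) (Y j)) {i : Fin N} {a : DVar N d} (ha : Sum.inr i ∈ ends a)
    (ha0 : ∀ x, basePoint x a = 0) :
    Good.{u} K (fun m p => linConst K c Γ m p + 1) (Sum.inr i)
      (fun D z => ∑ j, z (.X i j) * Y j D z + z a) := by
  have h := (Good.linear hN (c := c) (by simpa using hd) (ν := Sum.inr i) (opp := Sum.inl)
    Sum.inl_injective (e := fun j => (i, j)) (Prod.mk_right_injective i) (fun j => rfl)
    (fun j => by simp) hY).add (Good.coord ha ha0)
  convert h using 1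
  funext D z
  simp [GFOM.coord, xv, Finset.sum_apply]

theorem Good.col {c : ℕ} {Γ : ℕ → ℕ → ℝ≥0} (hN : 0 < N) (hN' : N ≤ c * N) {Y : Fin N → Fnl N d}
    (hY : ∀ i, Good.{u} K Γ (Sum.inr i) (Y i)) {j : Fin d} {a : DVar N d} (ha : Sum.inl j ∈ ends a)
    (ha0 : ∀ x, basePoint x a = 0) :
    Good.{u} K (fun m p => linConst K c Γ m p + 1) (Sum.inl j)
      (fun D z => ∑ i, z (.X i j) * Y i D z + z a) := by
  have h := (Good.linear hN (c := c) (by simpa using hN') (ν := Sum.inl j) (opp := Sum.inr)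
    Sum.inr_injective (e := fun i => (i, j)) (Prod.mk_left_injective j)
    (fun i => Finset.pair_comm _ _) (fun i => by simp) hY).add (Good.coord ha ha0)
  convert h using 1
  funext D z
  simp [GFOM.coord, xv, Finset.sum_apply]

theorem Good.signal (k : Fin d ⊕ Fin N) (j : Fin d) :
    Good.{u} K (fun _ p => K p) k (fun D _ => D.θ j : Fnl N d) :=
  Good.const (measurable_θ j) (fun _ _ => rfl) (fun _ _ _ _ hD => hD.norm_θ j) k

theorem Good.init (k : Fin d ⊕ Fin N) (j : Fin d) :
    Good.{u} K (fun _ p => K p) k (fun D _ => D.v0 j : Fnl N d) :=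
  Good.const (measurable_v0 j) (fun _ _ => rfl) (fun _ _ _ _ hD => hD.norm_v0 j) k

theorem Good.noise (k : Fin d ⊕ Fin N) (s : ℕ) (i : Fin N) :
    Good.{u} K (fun _ p => K p) k (fun D _ => D.w (s + 1) i : Fnl N d) :=
  Good.const (measurable_w s i) (fun _ _ => rfl) (fun _ _ _ _ hD => hD.norm_w s i) k

theorem Good.noiseTilde (k : Fin d ⊕ Fin N) (s : ℕ) (j : Fin d) :
    Good.{u} K (fun _ p => K p) k (fun D _ => D.wt (s + 1) j : Fnl N d) :=
  Good.const (measurable_wt s j) (fun _ _ => rfl) (fun _ _ _ _ hD => hD.norm_wt s j) k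

/-- The vectors along which the arguments of `F_t` vary. -/
def dirF (t : ℕ) : Unit ⊕ Fin t ⊕ Fin t → ℝ × (Fin t → ℝ) × (Fin t → ℝ)
  | .inl _ => (1, 0, 0)
  | .inr (.inl k) => (0, Pi.single k 1, 0)
  | .inr (.inr k) => (0, 0, Pi.single k 1)

/-- The vectors along which the arguments of `G_t` vary. -/
def dirG (t : ℕ) : Unit ⊕ Fin t ⊕ Fin t → (Fin t → ℝ) × ℝ × (Fin t → ℝ)
  | .inl _ => (0, 1, 0)
  | .inr (.inl k) => (Pi.single k 1, 0, 0)
  | .inr (.inr k) => (0, 0, Pi.single k 1)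

theorem sum_smul_single {t : ℕ} (x : Fin t → ℝ) :
    ∑ k, x k • (Pi.single k 1 : Fin t → ℝ) = x := by
  funext l
  simp [Finset.sum_apply, Pi.single_apply]

theorem sum_dirF {t : ℕ} (a : ℝ) (x y : Fin t → ℝ) :
    ∑ k, (Sum.elim (fun _ => a) (Sum.elim x y) : Unit ⊕ Fin t ⊕ Fin t → ℝ) k • dirF t k
      = (a, x, y) := by
  rw [Fintype.sum_sum_type, Fintype.sum_sum_type]
  refine Prod.ext ?_ (Prod.ext ?_ ?_)
  · simp [dirF, Prod.fst_sum]
  · simpa [dirF, Prod.fst_sum, Prod.snd_sum] using sum_smul_single x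
  · simpa [dirF, Prod.fst_sum, Prod.snd_sum] using sum_smul_single y

theorem sum_dirG {t : ℕ} (a : ℝ) (x y : Fin t → ℝ) :
    ∑ k, (Sum.elim (fun _ => a) (Sum.elim x y) : Unit ⊕ Fin t ⊕ Fin t → ℝ) k • dirG t k
      = (x, a, y) := by
  rw [Fintype.sum_sum_type, Fintype.sum_sum_type]
  refine Prod.ext ?_ (Prod.ext ?_ ?_)
  · simpa [dirG, Prod.fst_sum] using sum_smul_single x
  · simp [dirG, Prod.fst_sum, Prod.snd_sum]
  · simpa [dirG, Prod.fst_sum, Prod.snd_sum] using sum_smul_single y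

theorem u_eq_compFnl (F : FFun) (G : GFun) (t : ℕ) (i : Fin N) :
    (fun D z => u F G D z t i : Fnl N d) = compFnl (F t) (dirF t)
      (Sum.elim (fun _ D z => bstar D z i) (Sum.elim (fun k D z => b F G D z (k + 1) i)
        fun k D _ => D.w (k + 1) i)) := by
  funext D z
  rw [u, compFnl, ← sum_dirF]
  refine congrArg (F t) (Finset.sum_congr rfl fun k _ => ?_)
  rcases k with _ | k | k <;> rfl

theorem v_eq_compFnl (F : FFun) (G : GFun) (t : ℕ) (j : Fin d) :
    (fun D z => v F G D z (t + 1) j : Fnl N d) = compFnl (G (t + 1)) (dirG (t + 1))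
      (Sum.elim (fun _ D _ => D.v0 j) (Sum.elim (fun k D z => h F G D z (k + 1) j)
        fun k D _ => D.wt (k + 1) j)) := by
  funext D z
  rw [v, compFnl, ← sum_dirG]
  refine congrArg (G (t + 1)) (Finset.sum_congr rfl fun k _ => ?_)
  rcases k with _ | k | k <;> rfl

/-- The orbit up to time `t` is good. -/
def GoodOrbit (K : ℕ → ℝ≥0) (F : FFun) (G : GFun) (Γ : ℕ → ℕ → ℝ≥0) (N d t : ℕ) : Prop :=
  (∀ i, Good.{u} K Γ (Sum.inr i) (fun D z => bstar D z i : Fnl N d)) ∧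
  ∀ s ≤ t, (∀ j, Good.{u} K Γ (Sum.inl j) (fun D z => v F G D z s j : Fnl N d)) ∧
    (1 ≤ s → (∀ i, Good.{u} K Γ (Sum.inr i) (fun D z => b F G D z s i : Fnl N d)) ∧
      (∀ i, Good.{u} K Γ (Sum.inr i) (fun D z => u F G D z s i : Fnl N d)) ∧
      ∀ j, Good.{u} K Γ (Sum.inl j) (fun D z => h F G D z s j : Fnl N d))

/-- Each time step applies a matrix product, `F`, the transposed product and `G`. The constants
depend on the dimensions only through `c`, which bounds both `d / N` and 1, the ratios needed for
the row and column sums. -/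
theorem exists_goodOrbit (K : ℕ → ℝ≥0) {c : ℕ} (hc : 1 ≤ c) {F : FFun} {G : GFun}
    (hF : ∀ t, 1 ≤ t → IsSmooth1b (F t)) (hG : ∀ t, 1 ≤ t → IsSmooth1b (G t)) (t : ℕ) :
    ∃ Γ : ℕ → ℕ → ℝ≥0, ∀ {N d : ℕ}, 0 < N → d ≤ c * N → GoodOrbit.{u} K F G Γ N d t := by
  induction t with
  | zero =>
    refine ⟨fun m p => K p + (linConst K c (fun _ p => K p) m p + 1), fun {N d} hN hd => ⟨?_, ?_⟩⟩
    · intro i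
      refine (Good.row hN hd (Y := fun j D _ => D.θ j) (fun j => Good.signal _ j) (a := .bstar i)
        (by simp [ends]) fun _ => rfl).mono fun m p => ?_
      exact le_add_of_nonneg_left zero_le
    · intro s hs
      obtain rfl := Nat.le_zero.1 hs
      refine ⟨fun j => ?_, fun h => absurd h (by simp)⟩
      have : (fun D z => v F G D z 0 j : Fnl N d) = fun D _ => D.v0 j := by
        funext D z
        rw [v]
      rw [this]
      exact (Good.init _ j).mono fun m p => le_add_of_nonneg_right zero_le
  | succ t ih =>
    obtain ⟨Γ, hΓ⟩ := ih
    -- One constant dominates all arguments of `F`: the data, the earlier fields and the new `b`.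
    -- Likewise `Γ₃` dominates all arguments of `G`.
    let Γ₁ : ℕ → ℕ → ℝ≥0 := fun m p => K p + Γ m p + (linConst K c Γ m p + 1)
    obtain ⟨Γ₂, hΓ₂⟩ := (hF (t + 1) (by omega)).exists_good.{u} K Γ₁ (dirF (t + 1))
    let Γ₃ : ℕ → ℕ → ℝ≥0 := fun m p => Γ₁ m p + Γ₂ m p + (linConst K c Γ₂ m p + 1)
    obtain ⟨Γ₄, hΓ₄⟩ := (hG (t + 1) (by omega)).exists_good.{u} K Γ₃ (dirG (t + 1))
    have h01 : ∀ m p, Γ m p ≤ Γ₁ m p := fun m p =>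
      (le_add_of_nonneg_left zero_le).trans (le_add_of_nonneg_right zero_le)
    have hK1 : ∀ m p, K p ≤ Γ₁ m p := fun m p =>
      (le_add_of_nonneg_right zero_le).trans (le_add_of_nonneg_right zero_le)
    have h13 : ∀ m p, Γ₁ m p ≤ Γ₃ m p := fun m p =>
      (le_add_of_nonneg_right zero_le).trans (le_add_of_nonneg_right zero_le)
    have h23 : ∀ m p, Γ₂ m p ≤ Γ₃ m p := fun m p =>
      (le_add_of_nonneg_left zero_le).trans (le_add_of_nonneg_right zero_le)
    have h35 : ∀ m p, Γ₃ m p ≤ Γ₃ m p + Γ₄ m p := fun m p => le_add_of_nonneg_right zero_le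
    refine ⟨fun m p => Γ₃ m p + Γ₄ m p, fun {N d} hN hd => ?_⟩
    obtain ⟨hbs, hst⟩ := hΓ hN hd
    have hb : ∀ i, Good.{u} K Γ₁ (Sum.inr i) (fun D z => b F G D z (t + 1) i : Fnl N d) := by
      intro i
      have : (fun D z => b F G D z (t + 1) i : Fnl N d)
          = fun D z => ∑ j, z (.X i j) * v F G D z t j + z (.b (t + 1) i) := by
        funext D z
        rw [b]
      rw [this]
      exact (Good.row hN hd (Y := fun j D z => v F G D z t j) (hst t le_rfl).1 (by simp [ends])
        fun _ => rfl).mono fun m p => le_add_of_nonneg_left zero_le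
    have hu : ∀ i, Good.{u} K Γ₂ (Sum.inr i) (fun D z => u F G D z (t + 1) i : Fnl N d) := by
      intro i
      rw [u_eq_compFnl]
      refine hΓ₂ hN (Sum.inr i) _ ?_
      rintro (_ | k | k)
      · exact (hbs i).mono h01
      · rcases Nat.lt_or_ge k.1 t with hk | hk
        · exact (((hst (k + 1) (by omega)).2 (by omega)).1 i).mono h01
        · have : k.1 = t := by omega
          simpa only [Sum.elim_inr, Sum.elim_inl, this] using hb i
      · exact (Good.noise _ k i).mono hK1
    have hh : ∀ j, Good.{u} K Γ₃ (Sum.inl j) (fun D z => h F G D z (t + 1) j : Fnl N d) := by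
      intro j
      have : (fun D z => h F G D z (t + 1) j : Fnl N d)
          = fun D z => ∑ i, z (.X i j) * u F G D z (t + 1) i + z (.h (t + 1) j) := by
        funext D z
        rw [h]
      rw [this]
      exact (Good.col hN (Nat.le_mul_of_pos_left N hc) (Y := fun i D z => u F G D z (t + 1) i) hu
        (by simp [ends]) fun _ => rfl).mono fun m p => le_add_of_nonneg_left zero_le
    have hv : ∀ j, Good.{u} K Γ₄ (Sum.inl j) (fun D z => v F G D z (t + 1) j : Fnl N d) := by
      intro j
      rw [v_eq_compFnl]
      refine hΓ₄ hN (Sum.inl j) _ ?_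
      rintro (_ | k | k)
      · exact (Good.init _ j).mono fun m p => (hK1 m p).trans (h13 m p)
      · rcases Nat.lt_or_ge k.1 t with hk | hk
        · exact (((hst (k + 1) (by omega)).2 (by omega)).2.2 j).mono fun m p =>
            (h01 m p).trans (h13 m p)
        · have : k.1 = t := by omega
          simpa only [Sum.elim_inr, Sum.elim_inl, this] using hh j
      · exact (Good.noiseTilde _ k j).mono fun m p => (hK1 m p).trans (h13 m p)
    have h05 : ∀ m p, Γ m p ≤ Γ₃ m p + Γ₄ m p := fun m p =>
      (h01 m p).trans ((h13 m p).trans (h35 m p))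
    refine ⟨fun i => (hbs i).mono h05, fun s hs => ?_⟩
    rcases Nat.lt_or_ge t s with hts | hts
    · obtain rfl : s = t + 1 := by omega
      exact ⟨fun j => (hv j).mono fun m p => le_add_of_nonneg_left zero_le,
        fun _ => ⟨fun i => (hb i).mono fun m p => (h13 m p).trans (h35 m p),
          fun i => (hu i).mono fun m p => (h23 m p).trans (h35 m p), fun j => (hh j).mono h35⟩⟩
    · obtain ⟨h₁, h₂⟩ := hst s hts
      exact ⟨fun j => (h₁ j).mono h05, fun h1 => ⟨fun i => ((h₂ h1).1 i).mono h05,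
        fun i => ((h₂ h1).2.1 i).mono h05, fun j => ((h₂ h1).2.2 j).mono h05⟩⟩

end Orbit

-- Moments of subgaussian and Gaussian variables

section Moments

variable {Ω : Type*} [MeasurableSpace Ω] {μ : Measure Ω}

/-- Doubling `K` gives room to pick an admissible parameter strictly below `2 * K`, so that
attainment of the infimum is not an issue. -/
theorem _root_.IsSubgaussian.lintegral_exp_le {K : ℝ} (hK : 0 < K) {Y : Ω → ℝ}
    (hY : IsSubgaussian μ K Y) :
    ∫⁻ ω, ENNReal.ofReal (Real.exp ((Y ω / (2 * K)) ^ 2)) ∂μ ≤ 2 := by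
  have hlt : subgaussianNorm μ Y < ENNReal.ofReal (2 * K) :=
    lt_of_le_of_lt hY ((ENNReal.ofReal_lt_ofReal_iff (by linarith)).2 (by linarith))
  obtain ⟨_, ⟨t, ht, rfl, hle⟩, hlt'⟩ := sInf_lt_iff.1 hlt
  have htK : t < 2 * K := (ENNReal.ofReal_lt_ofReal_iff (by linarith)).1 hlt'
  refine le_trans (lintegral_mono fun ω => ENNReal.ofReal_le_ofReal (Real.exp_le_exp.2 ?_)) hle
  rw [div_pow]
  gcongr

/-- The constant in the moment bounds of subgaussian variables. -/
def subgaussianConst (p : ℕ) : ℝ≥0 := 4 * p.factorial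

theorem _root_.IsSubgaussian.eLpNorm_le [IsProbabilityMeasure μ] {K : ℝ} (hK : 0 < K) {Y : Ω → ℝ}
    (hm : Measurable Y) (hY : IsSubgaussian μ K Y) (p : ℕ) :
    eLpNorm Y p μ ≤ (subgaussianConst p * K.toNNReal : ℝ≥0) := by
  rcases Nat.eq_zero_or_pos p with rfl | hp
  · simp
  have hq0 : 2 * p ≠ 0 := by omega
  set Z : Ω → ℝ := fun ω => Y ω / (2 * K) with hZ
  have h1 : ∀ ω, ‖Z ω‖ₑ ^ (2 * p) ≤ p.factorial * ENNReal.ofReal (Real.exp (Z ω ^ 2)) := fun ω => by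
    -- One term of the exponential series: `Z ^ (2 * p) ≤ p! * exp (Z ^ 2)`.
    have h := Real.pow_div_factorial_le_exp _ (sq_nonneg (Z ω)) p
    rw [div_le_iff₀ (by positivity), ← pow_mul, mul_comm (Real.exp _)] at h
    have h2 : ‖Z ω‖ₑ ^ (2 * p) = ENNReal.ofReal (Z ω ^ (2 * p)) := by
      rw [← enorm_pow, Real.enorm_of_nonneg (by rw [pow_mul]; positivity)]
    rw [h2, ← ENNReal.ofReal_natCast, ← ENNReal.ofReal_mul (by positivity)]
    exact ENNReal.ofReal_le_ofReal h
  have h2 : eLpNorm Z (2 * p : ℕ) μ ≤ ((2 * p.factorial : ℕ) : ℝ≥0∞) := by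
    rw [← ENNReal.pow_le_pow_left_iff hq0, eLpNorm_natCast_pow hq0]
    calc ∫⁻ ω, ‖Z ω‖ₑ ^ (2 * p) ∂μ
        ≤ ∫⁻ ω, p.factorial * ENNReal.ofReal (Real.exp (Z ω ^ 2)) ∂μ := lintegral_mono h1
      _ = p.factorial * ∫⁻ ω, ENNReal.ofReal (Real.exp (Z ω ^ 2)) ∂μ :=
          lintegral_const_mul' _ _ (by simp)
      _ ≤ p.factorial * 2 := by gcongr; exact hY.lintegral_exp_le hK
      _ = ((2 * p.factorial : ℕ) : ℝ≥0∞) := by push_cast; rw [mul_comm]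
      _ ≤ ((2 * p.factorial : ℕ) : ℝ≥0∞) ^ (2 * p) := by
          refine le_self_pow₀ ?_ hq0
          exact_mod_cast (by have := p.factorial_pos; omega : 1 ≤ 2 * p.factorial)
  have h3 : Y = (2 * K) • Z := by
    funext ω
    simp only [hZ, Pi.smul_apply, smul_eq_mul]
    field_simp
  have hpq : (p : ℝ≥0∞) ≤ ((2 * p : ℕ) : ℝ≥0∞) := by exact_mod_cast (by omega : p ≤ 2 * p)
  refine (eLpNorm_le_eLpNorm_of_exponent_le hpq hm.aestronglyMeasurable).trans ?_
  rw [h3]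
  refine eLpNorm_const_smul_le.trans ((mul_le_mul_right h2 _).trans (le_of_eq ?_))
  rw [Real.enorm_of_nonneg (by positivity), ENNReal.ofReal, ← ENNReal.coe_natCast,
    ← ENNReal.coe_mul, subgaussianConst, Real.toNNReal_mul (by norm_num)]
  congr 1
  simp
  ring

/-- The moment constants of the data. -/
def dataConst (σ : ℝ) (p : ℕ) : ℝ≥0 :=
  subgaussianConst p * σ.toNNReal + (eLpNorm id p (gaussianReal 0 1)).toNNReal

theorem eLpNorm_le_of_map_eq_gaussian {Y : Ω → ℝ} (hm : Measurable Y)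
    (hY : μ.map Y = gaussianReal 0 1) (σ : ℝ) (p : ℕ) : eLpNorm Y p μ ≤ dataConst σ p := by
  have h : eLpNorm Y p μ = eLpNorm id p (gaussianReal 0 1) := by
    rw [← hY, eLpNorm_map_measure measurable_id.aestronglyMeasurable hm.aemeasurable]
    rfl
  have hfin : eLpNorm id p (gaussianReal 0 1) ≠ ⊤ := by
    have := (memLp_id_gaussianReal (μ := 0) (v := 1) (p : ℝ≥0)).eLpNorm_ne_top
    simpa using this
  rw [h, dataConst, ENNReal.coe_add, ENNReal.coe_toNNReal hfin]
  exact le_add_of_nonneg_left zero_le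

end Moments

-- Regrouping independent variables

section Independence

variable {Ω α β γ : Type*} [MeasurableSpace Ω] [MeasurableSpace α] [MeasurableSpace β]
  [MeasurableSpace γ] {μ : Measure Ω} [IsProbabilityMeasure μ]

theorem indepFun_prodMk_right {A : Ω → α} {B : Ω → β} {C : Ω → γ} (hA : Measurable A)
    (hB : Measurable B) (hC : Measurable C) (hAB : IndepFun A B μ)
    (hABC : IndepFun (fun ω => (A ω, B ω)) C μ) : IndepFun A (fun ω => (B ω, C ω)) μ := by
  have hBC : IndepFun B C μ := hABC.comp measurable_snd measurable_id
  have : IsProbabilityMeasure (μ.map A) := Measure.isProbabilityMeasure_map hA.aemeasurable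
  have : IsProbabilityMeasure (μ.map B) := Measure.isProbabilityMeasure_map hB.aemeasurable
  have : IsProbabilityMeasure (μ.map C) := Measure.isProbabilityMeasure_map hC.aemeasurable
  rw [indepFun_iff_map_prod_eq_prod_map_map hA.aemeasurable (hB.prodMk hC).aemeasurable]
  rw [indepFun_iff_map_prod_eq_prod_map_map hA.aemeasurable hB.aemeasurable] at hAB
  rw [indepFun_iff_map_prod_eq_prod_map_map hB.aemeasurable hC.aemeasurable] at hBC
  rw [indepFun_iff_map_prod_eq_prod_map_map (hA.prodMk hB).aemeasurable hC.aemeasurable, hAB]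
    at hABC
  have h := congrArg (Measure.map MeasurableEquiv.prodAssoc) hABC
  rw [Measure.map_map MeasurableEquiv.prodAssoc.measurable ((hA.prodMk hB).prodMk hC)] at h
  rw [hBC]
  refine Eq.trans h ?_
  exact (measurePreserving_prodAssoc (μ.map A) (μ.map B) (μ.map C)).map_eq

end Independence

-- From the probabilistic assumptions to the model

section Data

variable {N d : ℕ} {Ω : Type*} [MeasurableSpace Ω] {μ : Measure Ω}

theorem Assumptions.measurable {σ : ℝ} {ν₀ : Measure (ℝ × ℝ)} {D : Ω → Data N d}
    (hD : Assumptions μ σ ν₀ D) : Measurable D := by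
  rw [measurable_data_iff]
  refine Measurable.prodMk ?_ (Measurable.prodMk ?_ (Measurable.prodMk ?_
    (Measurable.prodMk ?_ ?_)))
  · exact measurable_pi_lambda _ fun i => measurable_pi_lambda _ fun j => hD.meas_X i j
  · exact measurable_pi_lambda _ fun j => (hD.meas_init j).fst
  · exact measurable_pi_lambda _ fun j => (hD.meas_init j).snd
  · exact measurable_pi_lambda _ fun s => measurable_pi_lambda _ fun i => hD.meas_w s i
  · exact measurable_pi_lambda _ fun s => measurable_pi_lambda _ fun j => hD.meas_wt s j

/-- The entry is independent of the other entries; the initialization, the noise `w` and the noise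
`wt` are then adjoined one at a time, each being independent of everything before it. -/
theorem Assumptions.indep [IsProbabilityMeasure μ] {σ : ℝ} {ν₀ : Measure (ℝ × ℝ)} {D : Ω → Data N d}
    (hD : Assumptions μ σ ν₀ D) (a : Fin N × Fin d) :
    IndepFun (fun ω => (D ω).X a.1 a.2) (fun ω => (D ω).setX a 0) μ := by
  classical
  have hDm := hD.measurable
  have hX : Measurable fun ω => (D ω).X := measurable_X.comp hDm
  have hθ : Measurable fun ω => (D ω).θ :=
    measurable_pi_lambda _ fun j => (measurable_θ j).comp hDm
  have hv0 : Measurable fun ω => (D ω).v0 :=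
    measurable_pi_lambda _ fun j => (measurable_v0 j).comp hDm
  have hw : Measurable fun ω => fun s i => (D ω).w (s + 1) i :=
    measurable_pi_lambda _ fun s => measurable_pi_lambda _ fun i => hD.meas_w s i
  have hwt : Measurable fun ω => fun s j => (D ω).wt (s + 1) j :=
    measurable_pi_lambda _ fun s => measurable_pi_lambda _ fun j => hD.meas_wt s j
  let zX : (Fin N → Fin d → ℝ) → Fin N → Fin d → ℝ := fun x i j => if (i, j) = a then 0 else x i j
  have hzX : Measurable zX := by
    refine measurable_pi_lambda _ fun i => measurable_pi_lambda _ fun j => ?_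
    by_cases h : (i, j) = a
    · simp [zX, h]
    · simp only [zX, h, if_false]
      exact (measurable_pi_apply j).comp (measurable_pi_apply i)
  have hXa : Measurable fun x : Fin N → Fin d → ℝ => x a.1 a.2 :=
    (measurable_pi_apply a.2).comp (measurable_pi_apply a.1)
  have h1 : IndepFun (fun ω => (D ω).X a.1 a.2) (fun ω => zX (D ω).X) μ := by
    have h := hD.indep_X.indepFun_finset {a} (Finset.univ.erase a) (by simp)
      fun b => hD.meas_X b.1 b.2
    have hψ : Measurable fun (x : ↥(Finset.univ.erase a) → ℝ) (i : Fin N)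
        (j : Fin d) => if h : (i, j) = a then (0 : ℝ) else x ⟨(i, j), by simp [h]⟩ := by
      refine measurable_pi_lambda _ fun i => measurable_pi_lambda _ fun j => ?_
      by_cases h : (i, j) = a
      · simp [h]
      · simp only [h, dif_neg, not_false_eq_true]
        exact measurable_pi_apply _
    have h' := h.comp (measurable_pi_apply (⟨a, by simp⟩ : ({a} : Finset (Fin N × Fin d)))) hψ
    convert h' using 1
    · rfl
    · funext ω i j
      simp only [zX, Function.comp]
      split_ifs <;> rfl
  have h2 : IndepFun (fun ω => (D ω).X a.1 a.2) (fun ω => (zX (D ω).X, (D ω).θ, (D ω).v0)) μ :=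
    indepFun_prodMk_right (hXa.comp hX) (hzX.comp hX) (hθ.prodMk hv0) h1
      (hD.indep_init_X.symm.comp (hXa.prodMk hzX) measurable_id)
  have h3 := indepFun_prodMk_right (hXa.comp hX) ((hzX.comp hX).prodMk (hθ.prodMk hv0)) hw h2
    (hD.indep_w_rest.symm.comp (φ := fun q => (q.1 a.1 a.2, zX q.1, q.2.1, q.2.2))
      ((hXa.comp measurable_fst).prodMk ((hzX.comp measurable_fst).prodMk measurable_snd))
      measurable_id)
  have h4 := indepFun_prodMk_right (hXa.comp hX)
    (((hzX.comp hX).prodMk (hθ.prodMk hv0)).prodMk hw) hwt h3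
    (hD.indep_wt_rest.symm.comp
      (φ := fun q => (q.1 a.1 a.2, (zX q.1, q.2.1, q.2.2.1), q.2.2.2))
      ((hXa.comp measurable_fst).prodMk (((hzX.comp measurable_fst).prodMk
        (measurable_snd.fst.prodMk measurable_snd.snd.fst)).prodMk measurable_snd.snd.snd))
      measurable_id)
  have h5 : IndepFun (fun ω => (D ω).X a.1 a.2) (fun ω => ((D ω).setX a 0).toProd) μ :=
    h4.comp (ψ := fun q : (((Fin N → Fin d → ℝ) × (Fin d → ℝ) × (Fin d → ℝ)) × (ℕ → Fin N → ℝ)) ×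
      (ℕ → Fin d → ℝ) => (q.1.1.1, q.1.1.2.1, q.1.1.2.2, q.1.2, q.2)) measurable_id
      (measurable_fst.fst.fst.prodMk (measurable_fst.fst.snd.fst.prodMk
        (measurable_fst.fst.snd.snd.prodMk (measurable_fst.snd.prodMk measurable_snd))))
  rw [IndepFun_iff_Indep] at h5 ⊢
  -- The σ-algebra on the data is itself pulled back along `toProd`, so both maps generate the same
  -- σ-algebra on `Ω`.
  have hcomap : MeasurableSpace.comap (fun ω => (D ω).setX a 0) inferInstance
      = MeasurableSpace.comap (fun ω => ((D ω).setX a 0).toProd) inferInstance :=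
    MeasurableSpace.comap_comp
  rw [hcomap]
  exact h5

theorem Assumptions.model [IsProbabilityMeasure μ] {σ : ℝ} (hσ : 0 < σ) {ν₀ : Measure (ℝ × ℝ)} {D : Ω → Data N d}
    (hN : 0 < N) (hD : Assumptions μ σ ν₀ D) : Model (dataConst σ) μ D := by
  have hsub : ∀ p, ((subgaussianConst p * σ.toNNReal : ℝ≥0) : ℝ≥0∞) ≤ dataConst σ p := fun p =>
    ENNReal.coe_le_coe.2 (le_add_of_nonneg_right zero_le)
  have hinit : ∀ j (g : ℝ × ℝ → ℝ), Measurable g → IsSubgaussian ν₀ σ g → ∀ p : ℕ,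
      eLpNorm (fun ω => g ((D ω).θ j, (D ω).v0 j)) p μ ≤ dataConst σ p := by
    intro j g hg hs p
    -- The index `j` is what makes `ν₀` a probability measure, as the law of an actual pair.
    have : IsProbabilityMeasure ν₀ := by
      rw [← hD.law_init j]
      exact Measure.isProbabilityMeasure_map (hD.meas_init j).aemeasurable
    have h := hs.eLpNorm_le hσ hg p
    rw [← hD.law_init j, eLpNorm_map_measure hg.aestronglyMeasurable
      (hD.meas_init j).aemeasurable] at h
    exact h.trans (hsub p)
  exact {
    meas := hD.measurable
    indep := hD.indep
    mean := fun a => hD.mean_X a.1 a.2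
    norm_X := fun a p => by
      have hs : 0 < σ / √(N : ℝ) := by positivity
      refine ((hD.subgaussian_X a.1 a.2).eLpNorm_le hs (hD.meas_X a.1 a.2) p).trans ?_
      have h : (σ / √(N : ℝ)).toNNReal = σ.toNNReal * rN N := by
        rw [Real.toNNReal_div hσ.le, div_eq_mul_inv, rN]
        congr 2
        rw [← NNReal.coe_inj, Real.coe_toNNReal _ (Real.sqrt_nonneg _)]
        simp
      rw [h, ← mul_assoc, ENNReal.coe_mul, ENNReal.coe_mul (dataConst σ p)]
      exact mul_le_mul_left (hsub p) _
    norm_θ := fun j p => hinit j Prod.fst measurable_fst hD.subgaussian_fst p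
    norm_v0 := fun j p => hinit j Prod.snd measurable_snd hD.subgaussian_snd p
    norm_w := fun s i p => eLpNorm_le_of_map_eq_gaussian (hD.meas_w s i) (hD.law_w s i) σ p
    norm_wt := fun s j p => eLpNorm_le_of_map_eq_gaussian (hD.meas_wt s j) (hD.law_wt s j) σ p }

theorem Good.momentNorm_le {Ω : Type u} [MeasurableSpace Ω] {μ : Measure Ω}
    [IsProbabilityMeasure μ] {K : ℕ → ℝ≥0} {Γ : ℕ → ℕ → ℝ≥0} {k : Fin d ⊕ Fin N} {Y : Fnl N d}
    (hN : 0 < N) (hY : Good.{u} K Γ k Y) {D : Ω → Data N d} (hD : Model K μ D)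
    (P : List (DVar N d)) (p : ℝ) :
    momentNorm μ p (fun ω => dP P Y (D ω)) ≤ ENNReal.ofReal (Γ P.length ⌈p⌉₊) ∧
      (¬ AllReaching (P : Multiset (DVar N d)) k →
        momentNorm μ p (fun ω => dP P Y (D ω)) ≤ ENNReal.ofReal (Γ P.length ⌈p⌉₊ / √(N : ℝ))) := by
  have hp : ENNReal.ofReal p ≤ ((⌈p⌉₊ : ℕ) : ℝ≥0∞) := by
    rw [← ENNReal.ofReal_natCast]
    exact ENNReal.ofReal_le_ofReal (Nat.le_ceil p)
  have h : momentNorm μ p (fun ω => dP P Y (D ω)) ≤ (Γ P.length ⌈p⌉₊ * wt k P : ℝ≥0) :=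
    (eLpNorm_le_eLpNorm_of_exponent_le hp (hD.aesm (hY.1.pdl P))).trans
      (hY.2 Ω μ D hD P (by simp) ⌈p⌉₊)
  refine ⟨h.trans ?_, fun hk => h.trans ?_⟩
  · rw [ENNReal.ofReal_coe_nnreal, ENNReal.coe_le_coe]
    exact mul_le_of_le_one_right zero_le (wt_le_one hN k P)
  · have hw : wt k P = rN N := if_neg hk
    have : (Γ P.length ⌈p⌉₊ / √(N : ℝ) : ℝ) = ((Γ P.length ⌈p⌉₊ * rN N : ℝ≥0) : ℝ) := by
      rw [rN]
      push_cast
      rw [div_eq_mul_inv]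
    rw [hw, this, ENNReal.ofReal_coe_nnreal]

end Data

end GFOM

end

theorem theorem3 (α σ : ℝ) (hα : 0 < α) (hσ : 0 < σ) (F : GFOM.FFun) (G : GFOM.GFun)
    (hF : ∀ t, 1 ≤ t → IsSmooth1b (F t)) (hG : ∀ t, 1 ≤ t → IsSmooth1b (G t))
    (t : ℕ) (ht : 1 ≤ t) (m : ℕ) (p : ℝ) (hp : 1 ≤ p) :
    ∃ Γ : ℝ, ∀ (N d : ℕ), 0 < N → (d : ℝ) = α * N →
      ∀ (Ω : Type*) [MeasurableSpace Ω] (μ : Measure Ω) [IsProbabilityMeasure μ]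
        (ν₀ : Measure (ℝ × ℝ)) (D : Ω → GFOM.Data N d), GFOM.Assumptions μ σ ν₀ D →
      ∀ P : List (GFOM.DVar N d), P.length = m →
      ∀ (i : Fin N) (j : Fin d) (s : ℕ), 1 ≤ s → s ≤ t →
        (GFOM.momentNorm μ p (fun ω => GFOM.dP P (fun D z => GFOM.bstar D z i) (D ω))
            ≤ ENNReal.ofReal Γ ∧
          GFOM.momentNorm μ p (fun ω => GFOM.dP P (fun D z => GFOM.b F G D z s i) (D ω))
            ≤ ENNReal.ofReal Γ ∧
          GFOM.momentNorm μ p (fun ω => GFOM.dP P (fun D z => GFOM.u F G D z s i) (D ω))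
            ≤ ENNReal.ofReal Γ ∧
          GFOM.momentNorm μ p (fun ω => GFOM.dP P (fun D z => GFOM.h F G D z s j) (D ω))
            ≤ ENNReal.ofReal Γ ∧
          GFOM.momentNorm μ p (fun ω => GFOM.dP P (fun D z => GFOM.v F G D z s j) (D ω))
            ≤ ENNReal.ofReal Γ) ∧
        (¬ GFOM.AllReaching (P : Multiset (GFOM.DVar N d)) (Sum.inr i) →
          GFOM.momentNorm μ p (fun ω => GFOM.dP P (fun D z => GFOM.bstar D z i) (D ω))
            ≤ ENNReal.ofReal (Γ / √(N : ℝ)) ∧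
          GFOM.momentNorm μ p (fun ω => GFOM.dP P (fun D z => GFOM.b F G D z s i) (D ω))
            ≤ ENNReal.ofReal (Γ / √(N : ℝ)) ∧
          GFOM.momentNorm μ p (fun ω => GFOM.dP P (fun D z => GFOM.u F G D z s i) (D ω))
            ≤ ENNReal.ofReal (Γ / √(N : ℝ))) ∧
        (¬ GFOM.AllReaching (P : Multiset (GFOM.DVar N d)) (Sum.inl j) →
          GFOM.momentNorm μ p (fun ω => GFOM.dP P (fun D z => GFOM.h F G D z s j) (D ω))
            ≤ ENNReal.ofReal (Γ / √(N : ℝ)) ∧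
          GFOM.momentNorm μ p (fun ω => GFOM.dP P (fun D z => GFOM.v F G D z s j) (D ω))
            ≤ ENNReal.ofReal (Γ / √(N : ℝ))) := by
  obtain ⟨Γ, hΓ⟩ := GFOM.exists_goodOrbit (GFOM.dataConst σ) (c := ⌈α⌉₊ + 1) (by omega) hF hG t
  -- Bounds are available for integer moments; a real `p` is rounded up, by monotonicity of the
  -- norms on a probability space.
  refine ⟨Γ m ⌈p⌉₊, ?_⟩
  rintro N d hN hd Ω _ μ _ ν₀ D hD P rfl i j s hs hst
  have hM := hD.model hσ hN
  have hdN : d ≤ (⌈α⌉₊ + 1) * N := by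
    have h : (d : ℝ) ≤ ((⌈α⌉₊ + 1 : ℕ) : ℝ) * N := by
      rw [hd]
      gcongr
      push_cast
      linarith [Nat.le_ceil α]
    exact_mod_cast h
  obtain ⟨h₀, h⟩ := hΓ hN hdN
  obtain ⟨hv, h⟩ := h s hst
  obtain ⟨hb, hu, hh⟩ := h hs
  have e₀ := (h₀ i).momentNorm_le hN hM P p
  have e₁ := (hb i).momentNorm_le hN hM P p
  have e₂ := (hu i).momentNorm_le hN hM P p
  have e₃ := (hh j).momentNorm_le hN hM P p
  have e₄ := (hv j).momentNorm_le hN hM P p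
  exact ⟨⟨e₀.1, e₁.1, e₂.1, e₃.1, e₄.1⟩, fun hk => ⟨e₀.2 hk, e₁.2 hk, e₂.2 hk⟩,
    fun hk => ⟨e₃.2 hk, e₄.2 hk⟩⟩
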